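/- **Theorem (determinizability of non-deterministic deallocation automata).** Fix a countably infinite set $\mathbb A$ of names and let $\mathrm{Perm}(\mathbb A)$ be its group of finite permutations. A *nominal set* is a set with a $\mathrm{Perm}(\mathbb A)$-action in which every element $x$ has a finite support; $\mathrm{supp}(x)$ denotes the least finite support of $x$, and $a\mathrel{\#}x$ means $a\notin\mathrm{supp}(x)$. It is *orbit-finite* if it has finitely many orbits. For a nominal set $X$, $[\mathbb A]X$ is the set of classes $\langle a\rangle x$ of pairs $(a,x)\in\mathbb A\times X$ under: $(a,x)\sim(b,y)$ iff $(a\,c)\cdot x=(b\,c)\cdot y$ for some name $c$ with $c\ne a,b$ and $c\mathrel{\#}x,y$. *Words.* Let $\hat{\mathbb A}$ consist, for each $a\in\mathbb A$, of four letters: $a$ (free), $[\![a$ (allocation), $a]\!]$ (deallocation) and $[\![a]\!]$ (unknown), with the evident action, which acts letterwise on words. For a word $w$ over $\hat{\mathbb A}$, let $\mathrm{LO}(w)$ be the set of names whose first occurrence in $w$ is of the form $a$ or $a]\!]$, and $\mathrm{RC}(w)$ the set of names whose last occurrence in $w$ is of the form $a]\!]$ or $[\![a]\!]$. The word $w$ is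 *right-non-shadowing* if $\mathrm{RC}(u)\cap\mathrm{LO}(v)=\emptyset$ for every decomposition $w=uv$. The relation $\equiv_\alpha$ of *$\alpha$-equivalence* on right-non-shadowing words is the least transitive relation such that 1. $\epsilon\equiv_\alpha\epsilon$; 2. $[\![a\,w\equiv_\alpha[\![b\,w'$ if $\langle a\rangle w=\langle b\rangle w'$, where $w,w'$ are right-non-shadowing; 3. if $w\equiv_\alpha w'$, then $a\,w\equiv_\alpha a\,w'$ and $[\![a\,w\equiv_\alpha[\![a\,w'$; 4. if $w\equiv_\alpha w'$ and $a\notin\mathrm{LO}(w)$, then $a]\!]\,w\equiv_\alpha a]\!]\,w'$; 5. if $w\equiv_\alpha w'$ and $a,b\notin\mathrm{LO}(w)$, then $[\![a]\!]\,w\equiv_\alpha[\![b]\!]\,w'$. It is an equivalence relation; write $[w]_\alpha$ for the class of $w$. Let $\mathsf{db}$ map a word over $\hat{\mathbb A}$ to the word over $\mathbb A$ obtained by removing all brackets. For a set $L$ of $\alpha$-equivalence classes, put $\mathcal D(L)=\{\mathsf{db}(w)\mid w \text{ right-non-shadowing},\ [w]_\alpha\in L\}$. *Automata.* A *non-deterministic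 deallocation automaton* (NDA) $A=(Q,\Delta,i,F)$ consists of an orbit-finite nominal set $Q$ of states, an equivariant relation $\Delta\subseteq Q\times\hat{\mathbb A}\times Q$ (write $q\xrightarrow{\gamma}q'$ for $(q,\gamma,q')\in\Delta$), an initial state $i\in Q$ (not required to have empty support) and an equivariant set $F\subseteq Q$ of final states, such that - (left $\alpha$-invariance) if $\langle a\rangle q'=\langle b\rangle q''$, then $q\xrightarrow{[\![a}q'$ implies $q\xrightarrow{[\![b}q''$, and $q\xrightarrow{[\![a]\!]}q'$ implies $q\xrightarrow{[\![b]\!]}q''$; - (name erasure) if $q\xrightarrow{a]\!]}q'$ or $q\xrightarrow{[\![a]\!]}q'$, then $a\mathrel{\#}q'$; - (finite branching) for each $q\in Q$, the sets $\{(a,q')\mid q\xrightarrow{a}q'\}$, $\{\langle a\rangle q'\mid q\xrightarrow{[\![a}q'\}$, $\{(a,q')\mid q\xrightarrow{a]\!]}q'\}$ and $\{\langle a\rangle q'\mid q\xrightarrow{[\![a]\!]}q'\}$ are finite. Let $L_0(A)$ be the set of words over $\hat{\mathbb A}$ labelling a run of $A$ from $i$ to a final state (all of them are right-non-shadowing),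 and put $L_\alpha(A)=\{[w]_\alpha\mid w\in L_0(A)\}$ and $L_D(A)=\{\mathsf{db}(w)\mid w\in L_0(A)\}$. A *deterministic deallocation automaton* (DDA) is an NDA in which for all $q\in Q$ and $\gamma\in\hat{\mathbb A}$ there is at most one $q'$ with $q\xrightarrow{\gamma}q'$. For every NDA $A$ there exists a DDA $A_{\mathsf{DDA}}$ such that $$L_D(A_{\mathsf{DDA}})=\mathcal D(L_\alpha(A)).$$ -/

import Mathlib

universe u

/-! ### Nominal sets over a set `𝔸` of names -/

/-- The group of finite permutations of the set of names. -/
def FinPerm (𝔸 : Type*) : Subgroup (Equiv.Perm 𝔸) where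
  carrier := {π | {a | π a ≠ a}.Finite}
  one_mem' := by simp
  mul_mem' := by
    intro π σ hπ hσ
    refine (Set.Finite.union hπ hσ).subset ?_
    intro a ha
    by_contra h
    simp only [Set.mem_union, Set.mem_ofPred_eq, not_or, not_not] at h
    exact ha (by rw [Equiv.Perm.mul_apply, h.2, h.1])
  inv_mem' := by
    intro π hπ
    refine Set.Finite.subset hπ ?_
    intro a ha h
    exact ha (by rw [Equiv.Perm.inv_eq_iff_eq]; exact h.symm)

namespace FinPerm

open Classical in
/-- The transposition `(a b)`. -/
noncomputable def swap {𝔸 : Type*} (a b : 𝔸) : FinPerm 𝔸 :=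
  ⟨Equiv.swap a b, (Set.toFinite {a, b}).subset (by
    intro x hx
    by_contra h
    simp only [Set.mem_insert_iff, Set.mem_singleton_iff, not_or] at h
    exact hx (Equiv.swap_apply_of_ne_of_ne h.1 h.2))⟩

end FinPerm

/-- A set with an action of the finite permutations of names is nominal if each element has a
finite support. -/
class Nominal (𝔸 : Type*) (X : Type*) [MulAction (FinPerm 𝔸) X] : Prop where
  exists_finite_support : ∀ x : X, ∃ S : Set 𝔸, S.Finite ∧ MulAction.Supports (FinPerm 𝔸) S x

/-- The (least finite) support of `x`. -/
def supp (𝔸 : Type*) {X : Type*} [MulAction (FinPerm 𝔸) X] (x : X) : Set 𝔸 :=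
  ⋂₀ {S : Set 𝔸 | S.Finite ∧ MulAction.Supports (FinPerm 𝔸) S x}

/-- The name `c` is fresh for `x`. -/
def Fresh {𝔸 : Type*} {X : Type*} [MulAction (FinPerm 𝔸) X] (c : 𝔸) (x : X) : Prop :=
  c ∉ supp 𝔸 x

/-- `(a, x) ∼ (b, y)` iff `(a c) · x = (b c) · y` for some name `c` fresh for `a, b, x, y`. -/
def AbsRel {𝔸 : Type*} {X : Type*} [MulAction (FinPerm 𝔸) X] (p q : 𝔸 × X) : Prop :=
  ∃ c : 𝔸, c ≠ p.1 ∧ c ≠ q.1 ∧ Fresh c p.2 ∧ Fresh c q.2 ∧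
    FinPerm.swap p.1 c • p.2 = FinPerm.swap q.1 c • q.2

namespace Nominal

variable {𝔸 : Type*} {X : Type*} [MulAction (FinPerm 𝔸) X]

theorem supp_subset {x : X} {S : Set 𝔸} (hS : S.Finite)
    (h : MulAction.Supports (FinPerm 𝔸) S x) : supp 𝔸 x ⊆ S :=
  Set.sInter_subset_of_mem ⟨hS, h⟩

theorem finite_supp [Nominal 𝔸 X] (x : X) : (supp 𝔸 x).Finite := by
  obtain ⟨S, hS, h⟩ := exists_finite_support (𝔸 := 𝔸) x
  exact hS.subset (supp_subset hS h)

theorem swap_smul_of_notMem {x : X} {S : Set 𝔸} (h : MulAction.Supports (FinPerm 𝔸) S x)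
    {a b : 𝔸} (ha : a ∉ S) (hb : b ∉ S) : FinPerm.swap a b • x = x := by
  classical
  refine h _ fun s hs => ?_
  change Equiv.swap a b s = s
  exact Equiv.swap_apply_of_ne_of_ne (fun e => ha (e ▸ hs)) (fun e => hb (e ▸ hs))

theorem swap_conj {a c d : 𝔸} (hac : a ≠ c) (had : a ≠ d) :
    FinPerm.swap c d * FinPerm.swap a c = FinPerm.swap a d * FinPerm.swap c d := by
  classical
  apply Subtype.ext
  change Equiv.swap c d * Equiv.swap a c = Equiv.swap a d * Equiv.swap c d
  ext x
  simp only [Equiv.Perm.mul_apply, Equiv.swap_apply_def]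
  split_ifs <;> simp_all

theorem swap_smul_of_fresh [Infinite 𝔸] {x : X} {c d : 𝔸} (hc : Fresh c x) (hd : Fresh d x) :
    FinPerm.swap c d • x = x := by
  classical
  simp only [Fresh, supp, Set.mem_sInter, not_forall] at hc hd
  obtain ⟨S, ⟨hS, hSx⟩, hcS⟩ := hc
  obtain ⟨T, ⟨hT, hTx⟩, hdT⟩ := hd
  obtain ⟨e, he⟩ := ((hS.union hT).union (Set.toFinite {c, d})).exists_notMem
  simp only [Set.mem_union, Set.mem_insert_iff, Set.mem_singleton_iff, not_or] at he
  obtain ⟨⟨heS, heT⟩, hec, hed⟩ := he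
  by_cases hcd : c = d
  · subst hcd
    exact swap_smul_of_notMem hSx hcS hcS
  have h1 : FinPerm.swap c e • x = x := swap_smul_of_notMem hSx hcS heS
  have h2 : FinPerm.swap e d • x = x := swap_smul_of_notMem hTx heT hdT
  have key := swap_conj (a := c) (c := e) (d := d) (Ne.symm hec) hcd
  have := congrArg (· • x) key
  simp only [mul_smul, h1, h2] at this
  exact this.symm

theorem swap_smul_change [Infinite 𝔸] {a c d : 𝔸} {x : X} (hca : c ≠ a) (hda : d ≠ a)
    (hc : Fresh c x) (hd : Fresh d x) :
    FinPerm.swap c d • FinPerm.swap a c • x = FinPerm.swap a d • x := by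
  rw [← mul_smul, swap_conj hca.symm hda.symm, mul_smul, swap_smul_of_fresh hc hd]

/-- The choice of the fresh name in the definition of abstraction is immaterial. -/
theorem absRel_any [Infinite 𝔸] {p q : 𝔸 × X} (h : AbsRel p q) {d : 𝔸} (hdp : d ≠ p.1)
    (hdq : d ≠ q.1) (hp : Fresh d p.2) (hq : Fresh d q.2) :
    FinPerm.swap p.1 d • p.2 = FinPerm.swap q.1 d • q.2 := by
  obtain ⟨c, hcp, hcq, h1, h2, e⟩ := h
  rw [← swap_smul_change hcp hdp h1 hp, ← swap_smul_change hcq hdq h2 hq, e]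

theorem absRel_equivalence [Infinite 𝔸] [Nominal 𝔸 X] :
    Equivalence (AbsRel : 𝔸 × X → 𝔸 × X → Prop) where
  refl p := by
    obtain ⟨c, hc⟩ := ((finite_supp (𝔸 := 𝔸) p.2).union (Set.toFinite {p.1})).exists_notMem
    simp only [Set.mem_union, Set.mem_singleton_iff, not_or] at hc
    exact ⟨c, hc.2, hc.2, hc.1, hc.1, rfl⟩
  symm := by
    rintro p q ⟨c, h1, h2, h3, h4, e⟩
    exact ⟨c, h2, h1, h4, h3, e.symm⟩
  trans := by
    intro p q r hpq hqr
    obtain ⟨c, hc⟩ := (((finite_supp (𝔸 := 𝔸) p.2).union (finite_supp (𝔸 := 𝔸) q.2)).union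
      ((finite_supp (𝔸 := 𝔸) r.2).union (Set.toFinite {p.1, q.1, r.1}))).exists_notMem
    simp only [Set.mem_union, Set.mem_insert_iff, Set.mem_singleton_iff, not_or] at hc
    obtain ⟨⟨hp, hq⟩, hr, hp1, hq1, hr1⟩ := hc
    exact ⟨c, hp1, hr1, hp, hr, (absRel_any hpq hp1 hq1 hp hq).trans (absRel_any hqr hq1 hr1 hq hr)⟩

end Nominal

/-- The abstraction set `[𝔸]X`. -/
def Abstraction (𝔸 : Type*) (X : Type*) [Infinite 𝔸] [MulAction (FinPerm 𝔸) X]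
    [Nominal 𝔸 X] : Type _ :=
  Quotient (⟨AbsRel, Nominal.absRel_equivalence⟩ : Setoid (𝔸 × X))

/-- The equivalence class `⟨a⟩x` of `(a, x)` in `[𝔸]X`. -/
def abstr {𝔸 : Type*} {X : Type*} [Infinite 𝔸] [MulAction (FinPerm 𝔸) X] [Nominal 𝔸 X]
    (a : 𝔸) (x : X) : Abstraction 𝔸 X :=
  Quotient.mk _ (a, x)

/-! ### Words with explicit deallocation -/

/-- The alphabet `𝔸̂`: `use a` is the free letter `a`, `alloc a` is `⟦a` (with binder),
`dealloc a` is `a⟧` (with marker), and `unknown a` is `⟦a⟧` (with both). -/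
inductive Letter (𝔸 : Type*) where
  | use (a : 𝔸)
  | alloc (a : 𝔸)
  | dealloc (a : 𝔸)
  | unknown (a : 𝔸)

namespace Letter

/-- Remove binder and marker. -/
def name {𝔸 : Type*} : Letter 𝔸 → 𝔸
  | use a => a
  | alloc a => a
  | dealloc a => a
  | unknown a => a

/-- Rename the name that a letter carries. -/
def map {𝔸 : Type*} (f : 𝔸 → 𝔸) : Letter 𝔸 → Letter 𝔸
  | use a => use (f a)
  | alloc a => alloc (f a)
  | dealloc a => dealloc (f a)
  | unknown a => unknown (f a)

instance instMulAction (𝔸 : Type*) : MulAction (FinPerm 𝔸) (Letter 𝔸) where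
  smul π γ := γ.map fun a => π • a
  one_smul γ := by cases γ <;> rfl
  mul_smul π σ γ := by cases γ <;> rfl

end Letter

/-- Words over `𝔸̂`. -/
abbrev Word (𝔸 : Type*) : Type _ := List (Letter 𝔸)

namespace Word

variable {𝔸 : Type*}

instance instMulAction (𝔸 : Type*) : MulAction (FinPerm 𝔸) (Word 𝔸) where
  smul π w := List.map (fun γ => π • γ) w
  one_smul w := by
    change List.map (fun γ => (1 : FinPerm 𝔸) • γ) w = w
    simp only [one_smul, List.map_id_fun', id]
  mul_smul π σ w := by
    change List.map _ w = List.map _ (List.map _ w)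
    rw [List.map_map]
    exact List.map_congr_left fun γ _ => mul_smul π σ γ

theorem supports_names (w : Word 𝔸) :
    MulAction.Supports (FinPerm 𝔸) {a | a ∈ List.map Letter.name w} w := by
  intro π h
  change List.map (fun γ => π • γ) w = w
  conv_rhs => rw [← List.map_id w]
  refine List.map_congr_left fun γ hγ => ?_
  have : π • γ.name = γ.name := h (List.mem_map_of_mem hγ)
  cases γ with
  | use a => exact congrArg Letter.use this
  | alloc a => exact congrArg Letter.alloc this
  | dealloc a => exact congrArg Letter.dealloc this
  | unknown a => exact congrArg Letter.unknown this

theorem finite_names (w : Word 𝔸) : {a | a ∈ List.map Letter.name w}.Finite :=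
  List.finite_toSet _

instance instNominal (𝔸 : Type*) : Nominal 𝔸 (Word 𝔸) where
  exists_finite_support w := ⟨_, finite_names w, supports_names w⟩

/-- The debracket function. -/
def db (w : Word 𝔸) : List 𝔸 := List.map Letter.name w

/-- Left-open names. -/
def lo : Word 𝔸 → Set 𝔸
  | [] => ∅
  | .use a :: w => lo w ∪ {a}
  | .alloc a :: w => lo w \ {a}
  | .dealloc a :: w => lo w ∪ {a}
  | .unknown a :: w => lo w \ {a}

/-- Left-closed names. -/
def lc : Word 𝔸 → Set 𝔸
  | [] => ∅
  | .use a :: w => lc w \ {a}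
  | .alloc a :: w => lc w ∪ {a}
  | .dealloc a :: w => lc w \ {a}
  | .unknown a :: w => lc w ∪ {a}

/-- Right-closed names: a letter `a⟧` or `⟦a⟧` adds `a`, unless `a` occurs again later, i.e. is
left-closed or left-open in the rest of the word. -/
def rc : Word 𝔸 → Set 𝔸
  | [] => ∅
  | .use _ :: w => rc w
  | .alloc _ :: w => rc w
  | .dealloc a :: w => rc w ∪ ({a} \ (lc w ∪ lo w))
  | .unknown a :: w => rc w ∪ ({a} \ (lc w ∪ lo w))

/-- Right-non-shadowing words. -/
def RNS (w : Word 𝔸) : Prop :=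
  ∀ u v : Word 𝔸, w = u ++ v → rc u ∩ lo v = ∅

/-- `α`-equivalence of right-non-shadowing words. All words related by it are right-non-shadowing,
see `AlphaEq.rns` below. -/
inductive AlphaEq [Infinite 𝔸] : Word 𝔸 → Word 𝔸 → Prop
  | nil : AlphaEq [] []
  | rename {a b : 𝔸} {w w' : Word 𝔸} (hw : RNS w) (hw' : RNS w') (h : abstr a w = abstr b w') :
      AlphaEq (.alloc a :: w) (.alloc b :: w')
  | use (a : 𝔸) {w w' : Word 𝔸} (h : AlphaEq w w') : AlphaEq (.use a :: w) (.use a :: w')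
  | alloc (a : 𝔸) {w w' : Word 𝔸} (h : AlphaEq w w') : AlphaEq (.alloc a :: w) (.alloc a :: w')
  | dealloc {a : 𝔸} {w w' : Word 𝔸} (h : AlphaEq w w') (ha : a ∉ lo w) :
      AlphaEq (.dealloc a :: w) (.dealloc a :: w')
  | unknown {a b : 𝔸} {w w' : Word 𝔸} (h : AlphaEq w w') (hab : {a, b} ∩ lo w = ∅) :
      AlphaEq (.unknown a :: w) (.unknown b :: w')
  | trans {u v w : Word 𝔸} (h : AlphaEq u v) (h' : AlphaEq v w) : AlphaEq u w

theorem lo_append (u v : Word 𝔸) : lo (u ++ v) = lo u ∪ (lo v \ lc u) := by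
  induction u with
  | nil => ext x; simp [lo, lc]
  | cons γ u ih =>
    change lo (γ :: (u ++ v)) = _
    ext x
    cases γ <;> simp only [lo, lc, ih, Set.mem_union, Set.mem_sdiff, Set.mem_singleton_iff] <;> tauto

theorem lo_smul (π : FinPerm 𝔸) (w : Word 𝔸) (x : 𝔸) : π • x ∈ lo (π • w) ↔ x ∈ lo w := by
  induction w with
  | nil => exact Iff.rfl
  | cons γ w ih =>
    change _ ∈ lo (π • γ :: π • w : Word 𝔸) ↔ _
    cases γ with
    | use a =>
      change _ ∈ lo (π • w) ∪ {π • a} ↔ _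
      simp [lo, ih]
    | alloc a =>
      change _ ∈ lo (π • w) \ {π • a} ↔ _
      simp [lo, ih]
    | dealloc a =>
      change _ ∈ lo (π • w) ∪ {π • a} ↔ _
      simp [lo, ih]
    | unknown a =>
      change _ ∈ lo (π • w) \ {π • a} ↔ _
      simp [lo, ih]

theorem lo_subset_names (w : Word 𝔸) : lo w ⊆ {a | a ∈ List.map Letter.name w} := by
  induction w with
  | nil => simp [lo]
  | cons γ w ih =>
    intro x hx
    cases γ <;> simp only [lo, Set.mem_union, Set.mem_sdiff, Set.mem_singleton_iff] at hx <;>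
      simp only [Set.mem_ofPred_eq, List.map_cons, List.mem_cons, Letter.name] <;>
      first
        | exact Or.inr (ih hx.1)
        | exact hx.elim (fun h => Or.inr (ih h)) Or.inl

theorem lo_of_abs_eq [Infinite 𝔸] {a b : 𝔸} {w w' : Word 𝔸} (h : abstr a w = abstr b w') :
    lo w \ {a} ⊆ lo w' \ {b} := by
  classical
  have h : AbsRel (a, w) (b, w') := Quotient.exact h
  obtain ⟨c, hc⟩ := (((finite_names w).union (finite_names w')).union
    (Set.toFinite {a, b})).exists_notMem
  simp only [Set.mem_union, Set.mem_insert_iff, Set.mem_singleton_iff, not_or] at hc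
  obtain ⟨⟨hcw, hcw'⟩, hca, hcb⟩ := hc
  have e := Nominal.absRel_any h (d := c) hca hcb
    (fun hh => hcw (Nominal.supp_subset (finite_names w) (supports_names w) hh))
    (fun hh => hcw' (Nominal.supp_subset (finite_names w') (supports_names w') hh))
  rintro x ⟨hx, hxa⟩
  have hxc : x ≠ c := fun hh => hcw (lo_subset_names w (hh ▸ hx))
  have h1 : x ∈ lo (FinPerm.swap a c • w) := by
    rw [← lo_smul (FinPerm.swap a c)] at hx
    have : FinPerm.swap a c • x = x := Equiv.swap_apply_of_ne_of_ne hxa hxc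
    rwa [this] at hx
  simp only at e
  rw [e] at h1
  have hxb : x ≠ b := by
    rintro rfl
    have : FinPerm.swap x c • c = x := Equiv.swap_apply_right x c
    have h2 : FinPerm.swap x c • c ∈ lo (FinPerm.swap x c • w') := by rw [this]; exact h1
    exact hcw' (lo_subset_names w' ((lo_smul _ _ _).1 h2))
  have : FinPerm.swap b c • x = x := Equiv.swap_apply_of_ne_of_ne hxb hxc
  rw [← this, lo_smul] at h1
  exact ⟨h1, hxb⟩

theorem AlphaEq.lo_eq [Infinite 𝔸] {w w' : Word 𝔸} (h : AlphaEq w w') : lo w = lo w' := by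
  induction h with
  | nil => rfl
  | rename hw hw' h => exact (lo_of_abs_eq h).antisymm (lo_of_abs_eq h.symm)
  | use a h ih => simp [lo, ih]
  | alloc a h ih => simp [lo, ih]
  | dealloc h ha ih => simp [lo, ih]
  | @unknown a b w w' h hab ih =>
    have ha : a ∉ lo w := fun hh => Set.eq_empty_iff_forall_notMem.1 hab a ⟨by simp, hh⟩
    have hb : b ∉ lo w := fun hh => Set.eq_empty_iff_forall_notMem.1 hab b ⟨by simp, hh⟩
    simp only [lo, ← ih]
    rw [Set.sdiff_singleton_eq_self ha, Set.sdiff_singleton_eq_self hb]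
  | trans h h' ih ih' => exact ih.trans ih'

theorem rns_nil : RNS ([] : Word 𝔸) := by
  intro u v h
  have : u = [] := (List.append_eq_nil_iff.1 h.symm).1
  subst this
  simp [rc]

theorem RNS.tail {γ : Letter 𝔸} {w : Word 𝔸} (h : RNS (γ :: w)) : RNS w := by
  rintro u v rfl
  have := h (γ :: u) v rfl
  refine Set.eq_empty_of_subset_empty (fun x hx => ?_)
  rw [← this]
  refine ⟨?_, hx.2⟩
  cases γ <;> simp only [rc]
  · exact hx.1
  · exact hx.1
  · exact Or.inl hx.1
  · exact Or.inl hx.1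

theorem RNS.cons {γ : Letter 𝔸} {w : Word 𝔸} (h : RNS w)
    (hγ : ∀ a, γ = .dealloc a ∨ γ = .unknown a → a ∉ lo w) : RNS (γ :: w) := by
  intro u v e
  cases u with
  | nil => simp [rc]
  | cons δ u =>
    obtain ⟨rfl, rfl⟩ := List.cons_eq_cons.1 (show γ :: w = δ :: (u ++ v) from e)
    have hu := h u v rfl
    have aux : ∀ a, a ∉ lo (u ++ v) →
        (rc u ∪ ({a} \ (lc u ∪ lo u))) ∩ lo v = ∅ := by
      intro a ha
      rw [lo_append] at ha
      refine Set.eq_empty_of_subset_empty (fun x hx => ?_)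
      rcases hx.1 with h1 | ⟨h1, h2⟩
      · rw [← hu]; exact ⟨h1, hx.2⟩
      · cases h1
        exact (ha (Or.inr ⟨hx.2, fun hh => h2 (Or.inl hh)⟩)).elim
    cases γ with
    | use a => exact hu
    | alloc a => exact hu
    | dealloc a => exact aux a (hγ a (Or.inl rfl))
    | unknown a => exact aux a (hγ a (Or.inr rfl))

theorem RNS.notMem_lo {γ : Letter 𝔸} {w : Word 𝔸} (h : RNS (γ :: w)) {a : 𝔸}
    (hγ : γ = .dealloc a ∨ γ = .unknown a) : a ∉ lo w := by
  intro ha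
  have := h [γ] w rfl
  refine Set.eq_empty_iff_forall_notMem.1 this a ⟨?_, ha⟩
  rcases hγ with rfl | rfl <;> simp [rc, lc, lo]

theorem AlphaEq.rns [Infinite 𝔸] {w w' : Word 𝔸} (h : AlphaEq w w') : RNS w ∧ RNS w' := by
  induction h with
  | nil => exact ⟨rns_nil, rns_nil⟩
  | rename hw hw' h => exact ⟨hw.cons (by simp), hw'.cons (by simp)⟩
  | use a h ih => exact ⟨ih.1.cons (by simp), ih.2.cons (by simp)⟩
  | alloc a h ih => exact ⟨ih.1.cons (by simp), ih.2.cons (by simp)⟩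
  | dealloc h ha ih =>
    exact ⟨ih.1.cons (by simpa using ha), ih.2.cons (by rw [← h.lo_eq]; simpa using ha)⟩
  | @unknown a b w w' h hab ih =>
    have ha : a ∉ lo w := fun hh => Set.eq_empty_iff_forall_notMem.1 hab a ⟨by simp, hh⟩
    have hb : b ∉ lo w := fun hh => Set.eq_empty_iff_forall_notMem.1 hab b ⟨by simp, hh⟩
    exact ⟨ih.1.cons (by simpa using ha), ih.2.cons (by rw [← h.lo_eq]; simpa using hb)⟩
  | trans h h' ih ih' => exact ⟨ih.1, ih'.2⟩

theorem AlphaEq.of_rns [Infinite 𝔸] {w : Word 𝔸} (h : RNS w) : AlphaEq w w := by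
  induction w with
  | nil => exact .nil
  | cons γ w ih =>
    cases γ with
    | use a => exact (ih h.tail).use a
    | alloc a => exact (ih h.tail).alloc a
    | dealloc a => exact (ih h.tail).dealloc (h.notMem_lo (Or.inl rfl))
    | unknown a =>
      refine (ih h.tail).unknown ?_
      have := h.notMem_lo (Or.inr rfl)
      simpa using this

theorem AlphaEq.symm [Infinite 𝔸] {w w' : Word 𝔸} (h : AlphaEq w w') : AlphaEq w' w := by
  induction h with
  | nil => exact .nil
  | rename hw hw' h => exact .rename hw' hw h.symm
  | use a h ih => exact ih.use a
  | alloc a h ih => exact ih.alloc a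
  | dealloc h ha ih => exact ih.dealloc (h.lo_eq ▸ ha)
  | unknown h hab ih => exact ih.unknown (by rw [Set.pair_comm, ← h.lo_eq]; exact hab)
  | trans h h' ih ih' => exact ih'.trans ih

end Word

/-- The set of right-non-shadowing words. -/
def RNSWord (𝔸 : Type*) : Type _ := {w : Word 𝔸 // Word.RNS w}

/-- `α`-equivalence as an equivalence relation on right-non-shadowing words. -/
instance RNSWord.setoid (𝔸 : Type*) [Infinite 𝔸] : Setoid (RNSWord 𝔸) where
  r w w' := Word.AlphaEq w.1 w'.1
  iseqv := ⟨fun w => Word.AlphaEq.of_rns w.2, fun h => h.symm, fun h h' => h.trans h'⟩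

/-- `α`-equivalence classes of right-non-shadowing words; an alphatic language is a set of them. -/
def AlphaClass (𝔸 : Type*) [Infinite 𝔸] : Type _ := Quotient (RNSWord.setoid 𝔸)

/-- The class `[w]_α`. -/
def RNSWord.alphaClass {𝔸 : Type*} [Infinite 𝔸] (w : RNSWord 𝔸) : AlphaClass 𝔸 :=
  Quotient.mk _ w

/-- The local freshness semantics `𝒟(L)` of an alphatic language `L`. -/
def localFreshness {𝔸 : Type*} [Infinite 𝔸] (L : Set (AlphaClass 𝔸)) : Set (List 𝔸) :=
  {x | ∃ w : RNSWord 𝔸, w.alphaClass ∈ L ∧ Word.db w.1 = x}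

/-! ### Deallocation automata -/

/-- Non-deterministic deallocation automata. -/
structure NDA (𝔸 : Type u) [Infinite 𝔸] where
  /-- The orbit-finite nominal set of states. -/
  State : Type u
  [action : MulAction (FinPerm 𝔸) State]
  [nominal : Nominal 𝔸 State]
  [orbitFinite : Finite (MulAction.orbitRel.Quotient (FinPerm 𝔸) State)]
  /-- The transition relation. -/
  Δ : State → Letter 𝔸 → State → Prop
  /-- The initial state. -/
  init : State
  /-- The set of final states. -/
  final : Set State
  Δ_equivariant : ∀ (π : FinPerm 𝔸) (q : State) (γ : Letter 𝔸) (q' : State),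
    Δ q γ q' → Δ (π • q) (π • γ) (π • q')
  final_equivariant : ∀ (π : FinPerm 𝔸) (q : State), q ∈ final → π • q ∈ final
  left_alpha_alloc : ∀ (q q' q'' : State) (a b : 𝔸), abstr a q' = abstr b q'' →
    Δ q (.alloc a) q' → Δ q (.alloc b) q''
  left_alpha_unknown : ∀ (q q' q'' : State) (a b : 𝔸), abstr a q' = abstr b q'' →
    Δ q (.unknown a) q' → Δ q (.unknown b) q''
  erasure_dealloc : ∀ (q q' : State) (a : 𝔸), Δ q (.dealloc a) q' → Fresh a q'
  erasure_unknown : ∀ (q q' : State) (a : 𝔸), Δ q (.unknown a) q' → Fresh a q'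
  branching_use : ∀ q : State, {p : 𝔸 × State | Δ q (.use p.1) p.2}.Finite
  branching_alloc : ∀ q : State,
    {t : Abstraction 𝔸 State | ∃ a q', Δ q (.alloc a) q' ∧ t = abstr a q'}.Finite
  branching_dealloc : ∀ q : State, {p : 𝔸 × State | Δ q (.dealloc p.1) p.2}.Finite
  branching_unknown : ∀ q : State,
    {t : Abstraction 𝔸 State | ∃ a q', Δ q (.unknown a) q' ∧ t = abstr a q'}.Finite

attribute [instance] NDA.action NDA.nominal NDA.orbitFinite

namespace NDA

variable {𝔸 : Type u} [Infinite 𝔸]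

/-- The state `q` accepts the word `w`: there is a run on `w` from `q` to a final state. -/
def Accepts (A : NDA 𝔸) : A.State → Word 𝔸 → Prop
  | q, [] => q ∈ A.final
  | q, γ :: w => ∃ q', A.Δ q γ q' ∧ A.Accepts q' w

/-- The literal language `L₀(A)`. -/
def literalLanguage (A : NDA 𝔸) : Set (Word 𝔸) := {w | A.Accepts A.init w}

/-- The alphatic language `L_α(A)`. -/
def alphaticLanguage (A : NDA 𝔸) : Set (AlphaClass 𝔸) :=
  {t | ∃ w : RNSWord 𝔸, w.1 ∈ A.literalLanguage ∧ w.alphaClass = t}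

/-- The data language `L_D(A)`. -/
def dataLanguage (A : NDA 𝔸) : Set (List 𝔸) := Word.db '' A.literalLanguage

end NDA

/-- Deterministic deallocation automata: NDA whose transition relation is partially
deterministic. -/
structure DDA (𝔸 : Type u) [Infinite 𝔸] extends NDA 𝔸 where
  deterministic : ∀ (q : State) (γ : Letter 𝔸) (q' q'' : State), Δ q γ q' → Δ q γ q'' → q' = q''

/-!
The determinization simulates an NDA `A` on plain names. A *configuration* is a state `q` together
with the set `K` of names that may still be read as free names; the other names of `q` are
anonymous: forgetting elements of `K` is always allowed, and so is renaming `q` by a permutation that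
fixes `K`. This is justified by `Word.AlphaEq.smul_of_fix_lo`: a right-non-shadowing word does not
change up to `α`-equivalence when a permutation fixes its left-open names. Hence the configuration
`(q, K)` stands for the words `w` that are `α`-equivalent to a word accepted from `q` and satisfy
`lo w ⊆ K` (`NDA.ConfigAccepts`).

A state of the deterministic automaton is a set `N` of known names of bounded size and a set of
configurations `(q, K)` with `K ⊆ N`, closed under forgetting and renaming. Without a bound on `N`
such a subset construction would not be orbit-finite; with it, `N` can be moved into a fixed finite
set `S`, and a closed set of configurations is a union of the finitely many orbits under the
pointwise stabilizer of `S`. The bound costs nothing since only the data language matters: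
the brackets on the input letters are free to choose, and they are used to announce whether the name
being read is used again before it is allocated anew. When all announcements are correct, `N` consists
of the left-open names of the remaining word, which lie in the support of the current state of `A`,
and of some names of the initial state. The letter determines `N`, and the successor configurations
depend only on its name and on the new `N`, which yields determinism; `α`-invariance holds because
the bound name of a transition is never known at its source.

Soundness (`NDA.exists_configAccepts`) reads a run backwards and restores the letters used by `A`.
Completeness (`NDA.exists_accepts`) follows the left-open names of a word, using the inversion
`Word.AlphaEq.inv` of `α`-equivalence to rename the states of `A` along the way.
-/

universe v

open scoped Pointwise

/-! ### Finite permutations, supports and abstraction -/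

namespace FinPerm

variable {𝔸 : Type*}

theorem swap_smul_left (a b : 𝔸) : swap a b • a = b := by
  classical exact Equiv.swap_apply_left a b

theorem swap_smul_right (a b : 𝔸) : swap a b • b = a := by
  classical exact Equiv.swap_apply_right a b

theorem swap_smul_of_ne {a b x : 𝔸} (ha : x ≠ a) (hb : x ≠ b) : swap a b • x = x := by
  classical exact Equiv.swap_apply_of_ne_of_ne ha hb

theorem swap_mul_self (a b : 𝔸) : swap a b * swap a b = 1 := by
  classical exact Subtype.ext (Equiv.swap_mul_self a b)

theorem swap_smul_swap_smul {X : Type*} [MulAction (FinPerm 𝔸) X] (a b : 𝔸) (x : X) :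
    swap a b • swap a b • x = x := by
  rw [← mul_smul, swap_mul_self, one_smul]

theorem mul_swap (π : FinPerm 𝔸) (a b : 𝔸) : π * swap a b = swap (π • a) (π • b) * π := by
  classical
  apply Subtype.ext
  change π.1 * Equiv.swap a b = Equiv.swap (π.1 a) (π.1 b) * π.1
  exact Equiv.mul_swap_eq_swap_mul _ _ _

/-- Two finite families of names with the same equality pattern differ by a finite permutation. -/
theorem exists_smul_eq {ι : Type*} [Finite ι] (f g : ι → 𝔸) (h : ∀ i j, f i = f j ↔ g i = g j) :
    ∃ π : FinPerm 𝔸, ∀ i, π • f i = g i := by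
  classical
  cases nonempty_fintype ι
  suffices H : ∀ T : Finset ι, ∃ π : FinPerm 𝔸, ∀ i ∈ T, π • f i = g i by
    obtain ⟨π, hπ⟩ := H Finset.univ
    exact ⟨π, fun i => hπ i (Finset.mem_univ i)⟩
  intro T
  induction T using Finset.induction_on with
  | empty => exact ⟨1, by simp⟩
  | insert j T hj ih =>
    obtain ⟨π, hπ⟩ := ih
    by_cases hex : ∃ i ∈ T, f i = f j
    · obtain ⟨i, hi, e⟩ := hex
      refine ⟨π, fun k hk => ?_⟩
      rcases Finset.mem_insert.1 hk with rfl | hk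
      · rw [← e, hπ i hi]
        exact (h _ _).1 e
      · exact hπ k hk
    · push Not at hex
      refine ⟨swap (π • f j) (g j) * π, fun k hk => ?_⟩
      rw [mul_smul]
      rcases Finset.mem_insert.1 hk with rfl | hk
      · exact swap_smul_left _ _
      · rw [swap_smul_of_ne, hπ k hk]
        · exact fun e => hex k hk (smul_left_cancel π e)
        · rw [hπ k hk]
          exact fun e => hex k hk ((h _ _).2 e)

theorem smul_set_eq_of_fix {π : FinPerm 𝔸} {S : Set 𝔸} (h : ∀ a ∈ S, π • a = a) : π • S = S := by
  refine (Set.image_congr h).trans ?_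
  simp

end FinPerm

namespace Nominal

variable {𝔸 : Type u} {X : Type v} [MulAction (FinPerm 𝔸) X]

theorem supports_smul {x : X} {S : Set 𝔸} (π : FinPerm 𝔸)
    (h : MulAction.Supports (FinPerm 𝔸) S x) :
    MulAction.Supports (FinPerm 𝔸) (π • S) (π • x) := by
  intro σ hσ
  have : (π⁻¹ * σ * π) • x = x := h _ fun a ha => by
    rw [mul_smul, mul_smul, hσ (Set.smul_mem_smul_set ha), inv_smul_smul]
  rw [mul_smul, mul_smul] at this
  exact inv_smul_eq_iff.1 this

theorem smul_mem_supp {x : X} {a : 𝔸} (π : FinPerm 𝔸) (h : a ∈ supp 𝔸 x) :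
    π • a ∈ supp 𝔸 (π • x) := by
  rintro S ⟨hS, hSx⟩
  have h2 := supports_smul π⁻¹ hSx
  rw [inv_smul_smul] at h2
  exact Set.mem_inv_smul_set_iff.1 (h _ ⟨hS.smul_set, h2⟩)

theorem smul_mem_supp_iff {x : X} {a : 𝔸} (π : FinPerm 𝔸) :
    π • a ∈ supp 𝔸 (π • x) ↔ a ∈ supp 𝔸 x := by
  refine ⟨fun h => ?_, smul_mem_supp π⟩
  simpa using smul_mem_supp π⁻¹ h

theorem supp_smul (π : FinPerm 𝔸) (x : X) : supp 𝔸 (π • x) = π • supp 𝔸 x := by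
  ext a
  rw [Set.mem_smul_set_iff_inv_smul_mem, ← smul_mem_supp_iff π (x := x), smul_inv_smul]

theorem fresh_smul {x : X} {a : 𝔸} (π : FinPerm 𝔸) (h : Fresh a x) : Fresh (π • a) (π • x) :=
  fun h' => h ((smul_mem_supp_iff π).1 h')

/-- In an orbit-finite set, the supports have bounded size. -/
theorem exists_ncard_supp_le [Finite (MulAction.orbitRel.Quotient (FinPerm 𝔸) X)] :
    ∃ n : ℕ, ∀ x : X, (supp 𝔸 x).ncard ≤ n := by
  obtain ⟨n, hn⟩ := (Set.finite_range fun t : MulAction.orbitRel.Quotient (FinPerm 𝔸) X =>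
    (supp 𝔸 t.out).ncard).bddAbove
  refine ⟨n, fun x => ?_⟩
  have hx : (Quotient.mk _ x : MulAction.orbitRel.Quotient (FinPerm 𝔸) X).out ∈
      MulAction.orbit (FinPerm 𝔸) x :=
    MulAction.orbitRel_apply.1 (Quotient.mk_out (s := MulAction.orbitRel (FinPerm 𝔸) X) x)
  obtain ⟨π, hπ⟩ := hx
  have := hn ⟨Quotient.mk _ x, rfl⟩
  simp only at this hπ
  rwa [← hπ, supp_smul, Set.ncard_smul_set] at this

/-- An orbit-finite nominal set has finitely many orbits under the pointwise stabilizer of a finite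
set `S` of names. They are counted by classifying maps: the orbit of `π • x`, with `x` running over
representatives of the orbits of the full group, is determined by which names in a support of `x`
are mapped by `π` to which elements of `S`. -/
theorem exists_classifier [Nominal 𝔸 X]
    [Finite (MulAction.orbitRel.Quotient (FinPerm 𝔸) X)] {S : Set 𝔸}
    (hS : S.Finite) : ∃ (ι : Type (max u v)) (_ : Finite ι) (f : X → ι), ∀ x y, f x = f y →
      ∃ π : FinPerm 𝔸, (∀ a ∈ S, π • a = a) ∧ π • x = y := by
  have := hS.to_subtype
  let T := MulAction.orbitRel.Quotient (FinPerm 𝔸) X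
  choose s hs hsx using exists_finite_support (𝔸 := 𝔸) (X := X)
  have : ∀ x, Finite (s x) := fun x => (hs x).to_subtype
  have hout : ∀ x : X, ∃ π : FinPerm 𝔸, π • (Quotient.mk _ x : T).out = x := fun x =>
    MulAction.orbitRel_apply.1 (Setoid.symm' (MulAction.orbitRel (FinPerm 𝔸) X)
      (Quotient.mk_out (s := MulAction.orbitRel (FinPerm 𝔸) X) x))
  choose p hp using hout
  refine ⟨Σ t : T, Set (s t.out × S), inferInstance,
    fun x => ⟨Quotient.mk _ x, {z | p x • (z.1 : 𝔸) = z.2}⟩, fun x y h => ?_⟩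
  obtain ⟨h1, h2⟩ := Sigma.mk.inj_iff.1 h
  have hpx := hp x
  have hpy := hp y
  revert h2 hpx hpy
  generalize p x = σ
  generalize p y = τ
  generalize (Quotient.mk _ x : T) = t at h1
  generalize (Quotient.mk _ y : T) = t' at h1
  subst h1
  intro h2 hpx hpy
  have h2 := fun z : s t.out × S => Set.ext_iff.1 (eq_of_heq h2) z
  simp only [Set.mem_ofPred_eq, Prod.forall] at h2
  obtain ⟨π, hπ⟩ := FinPerm.exists_smul_eq (ι := S ⊕ s t.out)
    (Sum.elim (fun a => (a : 𝔸)) fun a => σ • (a : 𝔸))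
    (Sum.elim (fun a => (a : 𝔸)) fun a => τ • (a : 𝔸)) (by
      rintro (i | i) (j | j)
      · exact Iff.rfl
      · exact eq_comm.trans ((h2 j i).trans eq_comm)
      · exact h2 i j
      · exact (smul_left_cancel_iff σ).trans (smul_left_cancel_iff τ).symm)
  refine ⟨π, fun a ha => hπ (.inl ⟨a, ha⟩), ?_⟩
  have : (τ⁻¹ * π * σ) • t.out = t.out := hsx t.out _ fun {a} ha => by
    rw [mul_smul, mul_smul, inv_smul_eq_iff]
    exact hπ (.inr ⟨a, ha⟩)
  rw [mul_smul, mul_smul, inv_smul_eq_iff, hpx, hpy] at this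
  exact this

variable [Infinite 𝔸] [Nominal 𝔸 X]

theorem abstr_eq_iff {a b : 𝔸} {x y : X} : abstr a x = abstr b y ↔ AbsRel (a, x) (b, y) :=
  ⟨fun h => Quotient.exact h, fun h => Quotient.sound h⟩

theorem abstr_eq_swap {a c : 𝔸} {x : X} (hca : c ≠ a) (hc : Fresh c x) :
    abstr a x = abstr c (FinPerm.swap a c • x) := by
  obtain ⟨d, hd⟩ := (((finite_supp (𝔸 := 𝔸) x).union
    (finite_supp (𝔸 := 𝔸) (FinPerm.swap a c • x))).union (Set.toFinite {a, c})).exists_notMem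
  simp only [Set.mem_union, Set.mem_insert_iff, Set.mem_singleton_iff, not_or] at hd
  exact abstr_eq_iff.2 ⟨d, hd.2.1, hd.2.2, hd.1.1, hd.1.2,
    (swap_smul_change hca hd.2.1 hc hd.1.1).symm⟩

theorem abstr_eq_of_fresh {a b : 𝔸} {x : X} (ha : Fresh a x) (hb : Fresh b x) :
    abstr a x = abstr b x := by
  by_cases hab : b = a
  · rw [hab]
  · rw [abstr_eq_swap hab hb, swap_smul_of_fresh ha hb]

theorem abstr_injective (a : 𝔸) : Function.Injective (abstr a : X → Abstraction 𝔸 X) := by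
  intro x y h
  obtain ⟨c, -, -, -, -, e⟩ := abstr_eq_iff.1 h
  exact smul_left_cancel _ e

theorem abstr_smul {a b : 𝔸} {x y : X} (π : FinPerm 𝔸) (h : abstr a x = abstr b y) :
    abstr (π • a) (π • x) = abstr (π • b) (π • y) := by
  obtain ⟨c, h1, h2, h3, h4, e⟩ := abstr_eq_iff.1 h
  refine abstr_eq_iff.2 ⟨π • c, fun e => h1 (smul_left_cancel _ e),
    fun e => h2 (smul_left_cancel _ e), fresh_smul π h3, fresh_smul π h4, ?_⟩
  simp only at e ⊢
  rw [← mul_smul, ← mul_smul, ← FinPerm.mul_swap, ← FinPerm.mul_swap, mul_smul, mul_smul, e]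

/-- The elements of a finite set supported by `S` are themselves supported by `S`: a name outside
`S` on which an element depends could be replaced by infinitely many others. -/
theorem supp_subset_of_finite_invariant {Y : Set X} (hY : Y.Finite) {S : Set 𝔸} (hS : S.Finite)
    (h : ∀ π : FinPerm 𝔸, (∀ a ∈ S, π • a = a) → ∀ y ∈ Y, π • y ∈ Y) {y : X} (hy : y ∈ Y) :
    supp 𝔸 y ⊆ S := by
  intro b hb
  by_contra hbS
  have hinf : ((S ∪ supp 𝔸 y)ᶜ).Infinite := (hS.union (finite_supp (𝔸 := 𝔸) y)).infinite_compl
  have hmaps : Set.MapsTo (fun d => FinPerm.swap b d • y) (S ∪ supp 𝔸 y)ᶜ Y := by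
    intro d hd
    refine h _ (fun a ha => FinPerm.swap_smul_of_ne ?_ ?_) y hy
    · rintro rfl; exact hbS ha
    · rintro rfl; exact hd (Or.inl ha)
  obtain ⟨d, hd, d', hd', hne, e⟩ := hinf.exists_ne_map_eq_of_mapsTo hmaps hY
  have h1 : d ∈ supp 𝔸 (FinPerm.swap b d • y) := by
    have := smul_mem_supp (FinPerm.swap b d) hb
    rwa [FinPerm.swap_smul_left] at this
  have hdb : d ≠ b := by rintro rfl; exact hd (Or.inr hb)
  rw [e, ← FinPerm.swap_smul_of_ne hdb hne, smul_mem_supp_iff] at h1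
  exact hd (Or.inr h1)

end Nominal

/-! ### Renaming names that do not occur left-open -/

namespace Word

variable {𝔸 : Type u}

theorem smul_cons (π : FinPerm 𝔸) (γ : Letter 𝔸) (w : Word 𝔸) :
    π • (γ :: w : Word 𝔸) = (π • γ :: π • w : Word 𝔸) := rfl

theorem length_smul (π : FinPerm 𝔸) (w : Word 𝔸) : (π • w).length = w.length :=
  List.length_map _

theorem lo_finite (w : Word 𝔸) : (lo w).Finite := (finite_names w).subset (lo_subset_names w)

theorem fresh_of_notMem_names {c : 𝔸} {w : Word 𝔸} (h : c ∉ {a | a ∈ List.map Letter.name w}) :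
    Fresh c w :=
  fun h' => h (Nominal.supp_subset (finite_names w) (supports_names w) h')

theorem RNS.smul {w : Word 𝔸} (h : RNS w) (π : FinPerm 𝔸) : RNS (π • w) := by
  induction w with
  | nil => exact h
  | cons γ w ih =>
    rw [smul_cons]
    refine (ih h.tail).cons fun a ha => ?_
    obtain ⟨a, rfl⟩ : ∃ b, a = π • b := ⟨π⁻¹ • a, (smul_inv_smul _ _).symm⟩
    rw [lo_smul]
    refine h.notMem_lo ?_
    cases γ with
    | use b => exact absurd ha (by rintro (h | h) <;> cases h)
    | alloc b => exact absurd ha (by rintro (h | h) <;> cases h)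
    | dealloc b =>
      rcases ha with h | h
      · exact Or.inl (congrArg _ (smul_left_cancel π (Letter.dealloc.inj h)))
      · cases h
    | unknown b =>
      rcases ha with h | h
      · cases h
      · exact Or.inr (congrArg _ (smul_left_cancel π (Letter.unknown.inj h)))

variable [Infinite 𝔸]

theorem AlphaEq.smul {w w' : Word 𝔸} (h : AlphaEq w w') (π : FinPerm 𝔸) :
    AlphaEq (π • w) (π • w') := by
  induction h with
  | nil => exact .nil
  | rename hw hw' h => exact .rename (hw.smul π) (hw'.smul π) (Nominal.abstr_smul π h)
  | use a h ih => exact ih.use (π • a)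
  | alloc a h ih => exact ih.alloc (π • a)
  | dealloc h ha ih => exact ih.dealloc (a := π • _) (by rwa [lo_smul])
  | @unknown a b w w' h hab ih =>
    refine ih.unknown (a := π • a) (b := π • b) ?_
    refine Set.eq_empty_of_forall_notMem fun x ⟨hx, hx'⟩ => ?_
    rcases hx with rfl | rfl <;> rw [lo_smul] at hx'
    · exact hab.le ⟨Or.inl rfl, hx'⟩
    · exact hab.le ⟨Or.inr rfl, hx'⟩
  | trans h h' ih ih' => exact ih.trans ih'

theorem AlphaEq.alloc_swap {a c : 𝔸} {w : Word 𝔸} (h : RNS w) (hca : c ≠ a) (hc : Fresh c w) :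
    AlphaEq (.alloc a :: w) (.alloc c :: FinPerm.swap a c • w) :=
  .rename h (h.smul _) (Nominal.abstr_eq_swap hca hc)

/-- Only the left-open names of a right-non-shadowing word matter up to `α`-equivalence. -/
theorem AlphaEq.smul_of_fix_lo {π : FinPerm 𝔸} {w : Word 𝔸} (hw : RNS w)
    (h : ∀ a ∈ lo w, π • a = a) : AlphaEq (π • w) w := by
  -- The bound name is replaced by a fresh one, hence an induction on the length.
  induction hn : w.length generalizing w π with
  | zero =>
    rw [List.length_eq_zero_iff.1 hn]
    exact .nil
  | succ n ih =>
    cases w with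
    | nil => cases hn
    | cons γ v =>
      have hv := hw.tail
      have hlen : v.length = n := by simpa using hn
      rw [smul_cons]
      cases γ with
      | use a =>
        have ha : π • a = a := h a (Or.inr rfl)
        change AlphaEq (.use (π • a) :: π • v) _
        rw [ha]
        exact (ih hv (fun x hx => h x (Or.inl hx)) hlen).use a
      | dealloc a =>
        have ha : π • a = a := h a (Or.inr rfl)
        change AlphaEq (.dealloc (π • a) :: π • v) _
        have := ih hv (fun x hx => h x (Or.inl hx)) hlen
        rw [ha]
        refine this.dealloc ?_
        rw [this.lo_eq]
        exact hw.notMem_lo (Or.inl rfl)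
      | unknown a =>
        have ha := hw.notMem_lo (Or.inr rfl)
        have hfix : ∀ x ∈ lo v, π • x = x := fun x hx => h x ⟨hx, by rintro rfl; exact ha hx⟩
        have := ih hv hfix hlen
        refine this.unknown (a := π • a) ?_
        refine Set.eq_empty_of_forall_notMem fun x ⟨hx, hx'⟩ => ?_
        rw [this.lo_eq] at hx'
        rcases hx with rfl | rfl
        · have e := smul_left_cancel _ (hfix _ hx')
          rw [e] at hx'
          exact ha hx'
        · exact ha hx'
      | alloc a =>
        change AlphaEq (.alloc (π • a) :: π • v) _
        obtain ⟨c, hc⟩ := (((finite_names v).union (finite_names (π • v))).union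
          (Set.toFinite {a, π • a, π⁻¹ • a})).union π.2 |>.exists_notMem
        simp only [Set.mem_union, Set.mem_insert_iff, Set.mem_singleton_iff, not_or] at hc
        obtain ⟨⟨⟨hcv, hcv'⟩, hca, hcπa, -⟩, hcπ⟩ := hc
        have hπc : π • c = c := not_not.1 hcπ
        refine (alloc_swap (hv.smul π) hcπa (fresh_of_notMem_names hcv')).trans
          (AlphaEq.trans ?_ (alloc_swap hv hca (fresh_of_notMem_names hcv)).symm)
        refine AlphaEq.alloc c ?_
        have key : FinPerm.swap (π • a) c • π • v =
            (FinPerm.swap (π • a) c * π * FinPerm.swap a c) • FinPerm.swap a c • v := by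
          rw [mul_smul, FinPerm.swap_smul_swap_smul, mul_smul]
        rw [key]
        refine ih (hv.smul _) (fun x hx => ?_) ((length_smul _ _).trans hlen)
        obtain ⟨y, rfl⟩ : ∃ y, x = FinPerm.swap a c • y :=
          ⟨FinPerm.swap a c • x, (FinPerm.swap_smul_swap_smul _ _ _).symm⟩
        rw [lo_smul] at hx
        rw [mul_smul, FinPerm.swap_smul_swap_smul, mul_smul]
        by_cases hya : y = a
        · rw [hya, FinPerm.swap_smul_left, FinPerm.swap_smul_left]
        · have hyc : y ≠ c := by rintro rfl; exact hcv (lo_subset_names v hx)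
          have hπy : π • y = y := h y ⟨hx, hya⟩
          rw [hπy, FinPerm.swap_smul_of_ne hya hyc, FinPerm.swap_smul_of_ne _ hyc]
          intro e
          exact hya (smul_left_cancel π (hπy.trans e))

/-- What `α`-equivalence of two words says about their first letters and their tails; for binders it
holds after replacing the bound names by almost any name. -/
def AlphaInv : Word 𝔸 → Word 𝔸 → Prop
  | [], w' => w' = []
  | .use a :: v, w' => ∃ v', w' = .use a :: v' ∧ AlphaEq v v'
  | .dealloc a :: v, w' => ∃ v', w' = .dealloc a :: v' ∧ AlphaEq v v'
  | .unknown _ :: v, w' => ∃ b v', w' = .unknown b :: v' ∧ AlphaEq v v'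
  | .alloc a :: v, w' => ∃ b v', w' = .alloc b :: v' ∧ ∃ S : Set 𝔸, S.Finite ∧
      ∀ c ∉ S, AlphaEq (FinPerm.swap a c • v) (FinPerm.swap b c • v')

theorem AlphaEq.inv {w w' : Word 𝔸} (h : AlphaEq w w') : AlphaInv w w' := by
  induction h with
  | nil => rfl
  | @rename a b w w' hw hw' h =>
    refine ⟨b, w', rfl, _, ((finite_names w).union (finite_names w')).union
      (Set.toFinite {a, b}), fun c hc => ?_⟩
    simp only [Set.mem_union, Set.mem_insert_iff, Set.mem_singleton_iff, not_or] at hc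
    have := Nominal.absRel_any (Nominal.abstr_eq_iff.1 h) hc.2.1 hc.2.2
      (fresh_of_notMem_names hc.1.1) (fresh_of_notMem_names hc.1.2)
    simp only at this
    rw [this]
    exact .of_rns (hw'.smul _)
  | use a h ih => exact ⟨_, rfl, h⟩
  | alloc a h ih => exact ⟨_, _, rfl, ∅, Set.finite_empty, fun c _ => h.smul _⟩
  | dealloc h ha ih => exact ⟨_, rfl, h⟩
  | unknown h hab ih => exact ⟨_, _, rfl, h⟩
  | @trans u v w h h' ih ih' =>
    match u, ih with
    | [], e => subst e; exact ih'
    | .use a :: u, ⟨v', e, h1⟩ =>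
      subst e
      obtain ⟨w', rfl, h2⟩ := ih'
      exact ⟨w', rfl, h1.trans h2⟩
    | .dealloc a :: u, ⟨v', e, h1⟩ =>
      subst e
      obtain ⟨w', rfl, h2⟩ := ih'
      exact ⟨w', rfl, h1.trans h2⟩
    | .unknown a :: u, ⟨b, v', e, h1⟩ =>
      subst e
      obtain ⟨d, w', rfl, h2⟩ := ih'
      exact ⟨d, w', rfl, h1.trans h2⟩
    | .alloc a :: u, ⟨b, v', e, S, hS, h1⟩ =>
      subst e
      obtain ⟨d, w', rfl, T, hT, h2⟩ := ih'
      refine ⟨d, w', rfl, _, hS.union hT, fun c hc => ?_⟩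
      rw [Set.mem_union, not_or] at hc
      exact (h1 c hc.1).trans (h2 c hc.2)

end Word

/-! ### Runs of deallocation automata -/

namespace NDA

variable {𝔸 : Type u} [Infinite 𝔸] (A : NDA 𝔸)

theorem finite_successors (q : A.State) (γ : Letter 𝔸) : {q' | A.Δ q γ q'}.Finite := by
  cases γ with
  | use a => exact (A.branching_use q).preimage (f := Prod.mk a) (by intro x _ y _ h; cases h; rfl)
  | dealloc a =>
    exact (A.branching_dealloc q).preimage (f := Prod.mk a) (by intro x _ y _ h; cases h; rfl)
  | alloc a =>
    exact Set.Finite.subset ((A.branching_alloc q).preimage (Nominal.abstr_injective a).injOn)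
      fun q' h => ⟨a, q', h, rfl⟩
  | unknown a =>
    exact Set.Finite.subset ((A.branching_unknown q).preimage (Nominal.abstr_injective a).injOn)
      fun q' h => ⟨a, q', h, rfl⟩

variable {A}

theorem supp_subset_of_step {q q' : A.State} {γ : Letter 𝔸} (h : A.Δ q γ q') :
    supp 𝔸 q' ⊆ insert γ.name (supp 𝔸 q) := by
  intro x hx
  by_contra hx'
  simp only [Set.mem_insert_iff, not_or] at hx'
  simp only [supp, Set.mem_sInter, not_forall] at hx'
  obtain ⟨hxγ, S, ⟨hS, hSq⟩, hxS⟩ := hx'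
  have := Nominal.supp_subset_of_finite_invariant (A.finite_successors q γ)
    (hS.insert γ.name) (fun π hπ r hr => ?_) h hx
  · exact this.elim hxγ hxS
  · have h1 := A.Δ_equivariant π q γ r hr
    rw [hSq π fun {a} ha => hπ a (Or.inr ha)] at h1
    have h2 : π • γ = γ := by
      have : π • γ.name = γ.name := hπ _ (Or.inl rfl)
      cases γ <;> exact congrArg _ this
    rwa [h2] at h1

theorem name_mem_supp {q q' : A.State} {γ : Letter 𝔸} {a : 𝔸} (hγ : γ = .use a ∨ γ = .dealloc a)
    (h : A.Δ q γ q') : a ∈ supp 𝔸 q := by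
  by_contra ha
  have hsub : (supp 𝔸 q)ᶜ ⊆ {d | ∃ r, A.Δ q (.use d) r} ∪ {d | ∃ r, A.Δ q (.dealloc d) r} := by
    intro d hd
    have h1 := A.Δ_equivariant (FinPerm.swap a d) q γ q' h
    rw [Nominal.swap_smul_of_fresh ha hd] at h1
    rcases hγ with rfl | rfl
    · have : FinPerm.swap a d • Letter.use a = .use d :=
        congrArg Letter.use (FinPerm.swap_smul_left a d)
      rw [this] at h1
      exact Or.inl ⟨_, h1⟩
    · have : FinPerm.swap a d • Letter.dealloc a = .dealloc d :=
        congrArg Letter.dealloc (FinPerm.swap_smul_left a d)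
      rw [this] at h1
      exact Or.inr ⟨_, h1⟩
  refine ((Nominal.finite_supp (𝔸 := 𝔸) q).infinite_compl) (Set.Finite.subset ?_ hsub)
  refine ((A.branching_use q).image Prod.fst).union ((A.branching_dealloc q).image Prod.fst)
    |>.subset ?_
  rintro d (⟨r, hr⟩ | ⟨r, hr⟩)
  · exact Or.inl ⟨(d, r), hr, rfl⟩
  · exact Or.inr ⟨(d, r), hr, rfl⟩

theorem Accepts.smul {q : A.State} {w : Word 𝔸} (h : A.Accepts q w) (π : FinPerm 𝔸) :
    A.Accepts (π • q) (π • w) := by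
  induction w generalizing q with
  | nil => exact A.final_equivariant π q h
  | cons γ w ih =>
    obtain ⟨q', h1, h2⟩ := h
    exact ⟨π • q', A.Δ_equivariant π q γ q' h1, ih h2⟩

theorem Accepts.lo_subset_supp {q : A.State} {w : Word 𝔸} (h : A.Accepts q w) :
    Word.lo w ⊆ supp 𝔸 q := by
  induction w generalizing q with
  | nil => exact Set.empty_subset _
  | cons γ w ih =>
    obtain ⟨q', h1, h2⟩ := h
    have hsub := (ih h2).trans (supp_subset_of_step h1)
    cases γ with
    | use a =>
      have ha := name_mem_supp (Or.inl rfl) h1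
      rintro x (hx | rfl)
      · rcases hsub hx with rfl | hx
        exacts [ha, hx]
      · exact ha
    | dealloc a =>
      have ha := name_mem_supp (Or.inr rfl) h1
      rintro x (hx | rfl)
      · rcases hsub hx with rfl | hx
        exacts [ha, hx]
      · exact ha
    | alloc a => exact fun x hx => (hsub hx.1).resolve_left hx.2
    | unknown a => exact fun x hx => (hsub hx.1).resolve_left hx.2

end NDA

/-! ### The deterministic automaton -/

theorem FinPerm.exists_smul_set_eq {𝔸 : Type u} {S T : Set 𝔸} (hS : S.Finite) (hT : T.Finite)
    (h : S.ncard = T.ncard) : ∃ π : FinPerm 𝔸, π • S = T := by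
  have := hS.to_subtype
  have := hT.to_subtype
  obtain ⟨e⟩ : Nonempty (S ≃ T) := Finite.card_eq.1 h
  obtain ⟨π, hπ⟩ := FinPerm.exists_smul_eq (fun a : S => (a : 𝔸)) (fun a => (e a : 𝔸)) (by
    intro i j
    rw [Subtype.coe_inj, Subtype.coe_inj, e.apply_eq_iff_eq])
  refine ⟨π, Set.Subset.antisymm ?_ fun a ha => ?_⟩
  · rintro _ ⟨a, ha, rfl⟩
    exact Set.mem_of_eq_of_mem (hπ ⟨a, ha⟩) (e ⟨a, ha⟩).2
  · refine ⟨e.symm ⟨a, ha⟩, (e.symm ⟨a, ha⟩).2, ?_⟩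
    exact (hπ _).trans (by rw [e.apply_symm_apply])

theorem FinPerm.conj_fix {𝔸 : Type u} {π σ : FinPerm 𝔸} {K : Set 𝔸} (h : ∀ x ∈ K, σ • x = x) :
    ∀ x ∈ π • K, (π * σ * π⁻¹) • x = x := by
  rintro _ ⟨x, hx, rfl⟩
  change (π * σ * π⁻¹) • π • x = π • x
  rw [mul_smul, inv_smul_smul, mul_smul, h x hx]

/-- The letters `a` and `a⟧`, whose name has to be known when they are read. -/
def Letter.IsFree {𝔸 : Type u} : Letter 𝔸 → Prop
  | .use _ => True
  | .alloc _ => False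
  | .dealloc _ => True
  | .unknown _ => False

/-- The set of known names after reading a letter, if `N` is the set before. -/
def Letter.update {𝔸 : Type u} : Letter 𝔸 → Set 𝔸 → Set 𝔸
  | .use _, N => N
  | .alloc a, N => insert a N
  | .dealloc a, N => N \ {a}
  | .unknown _, N => N

namespace Letter

variable {𝔸 : Type u}

theorem isFree_smul (π : FinPerm 𝔸) (γ : Letter 𝔸) : (π • γ).IsFree ↔ γ.IsFree := by
  cases γ <;> exact Iff.rfl

theorem name_smul (π : FinPerm 𝔸) (γ : Letter 𝔸) : (π • γ).name = π • γ.name := by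
  cases γ <;> rfl

theorem update_smul (π : FinPerm 𝔸) (γ : Letter 𝔸) (N : Set 𝔸) :
    (π • γ).update (π • N) = π • γ.update N := by
  cases γ with
  | use a => rfl
  | alloc a => exact (Set.smul_set_insert π a N).symm
  | dealloc a =>
    change π • N \ {π • a} = π • (N \ {a})
    rw [Set.smul_set_sdiff, Set.smul_set_singleton]
  | unknown a => rfl

end Letter

namespace NDA

variable {𝔸 : Type u} [Infinite 𝔸] (A : NDA 𝔸)

/-- A configuration of `A` reading plain names: a state together with the set of names that may
still be read as free names. All other names of the state count as anonymous. -/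
abbrev Config : Type u := A.State × Set 𝔸

/-- Reading the name `a`: a transition of `A` with an arbitrary letter of this name, after which
known names may be forgotten and anonymous ones renamed. -/
def ConfigStep (a : 𝔸) (p p' : A.Config) : Prop :=
  ∃ (γ : Letter 𝔸) (q : A.State) (π : FinPerm 𝔸), γ.name = a ∧ A.Δ p.1 γ q ∧
    (γ.IsFree → a ∈ p.2) ∧ p'.2 ⊆ insert a p.2 ∧ (∀ x ∈ p'.2, π • x = x) ∧ p'.1 = π • q

/-- A set of configurations that is closed under forgetting known names and renaming anonymous
ones. -/
def DropClosed (P : Set A.Config) : Prop :=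
  ∀ p ∈ P, ∀ K ⊆ p.2, ∀ π : FinPerm 𝔸, (∀ x ∈ K, π • x = x) → (π • p.1, K) ∈ P

/-- The configurations reached from `P` by reading `a`, with known names in `N`. -/
def succConfigs (P : Set A.Config) (a : 𝔸) (N : Set 𝔸) : Set A.Config :=
  {p' | p'.2 ⊆ N ∧ ∃ p ∈ P, A.ConfigStep a p p'}

variable {A}

theorem ConfigStep.smul {a : 𝔸} {p p' : A.Config} (h : A.ConfigStep a p p') (π : FinPerm 𝔸) :
    A.ConfigStep (π • a) (π • p) (π • p') := by
  obtain ⟨γ, q, σ, rfl, h1, h2, h3, h4, h5⟩ := h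
  refine ⟨π • γ, π • q, π * σ * π⁻¹, Letter.name_smul π γ, A.Δ_equivariant π _ _ _ h1, fun hf => ?_,
    ?_, FinPerm.conj_fix h4, ?_⟩
  · exact Set.smul_mem_smul_set (h2 ((Letter.isFree_smul π γ).1 hf))
  · change π • p'.2 ⊆ insert (π • γ.name) (π • p.2)
    rw [← Set.smul_set_insert]
    exact Set.smul_set_mono h3
  · change π • p'.1 = _
    rw [h5, mul_smul, inv_smul_smul, mul_smul]

theorem succConfigs_smul (P : Set A.Config) (a : 𝔸) (N : Set 𝔸) (π : FinPerm 𝔸) :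
    A.succConfigs (π • P) (π • a) (π • N) = π • A.succConfigs P a N := by
  have key : ∀ (P : Set A.Config) (a : 𝔸) (N : Set 𝔸) (π : FinPerm 𝔸),
      π • A.succConfigs P a N ⊆ A.succConfigs (π • P) (π • a) (π • N) := by
    rintro P a N π _ ⟨p', ⟨h1, p, hp, h2⟩, rfl⟩
    exact ⟨Set.smul_set_mono h1, π • p, Set.smul_mem_smul_set hp, h2.smul π⟩
  refine Set.Subset.antisymm ?_ (key P a N π)
  have := Set.smul_set_mono (a := π) (key (π • P) (π • a) (π • N) π⁻¹)
  simpa only [smul_inv_smul, inv_smul_smul] using this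

theorem DropClosed.smul {P : Set A.Config} (h : A.DropClosed P) (π : FinPerm 𝔸) :
    A.DropClosed (π • P) := by
  rintro _ ⟨p, hp, rfl⟩ K hK σ hσ
  refine Set.mem_smul_set_iff_inv_smul_mem.2 ?_
  have hsub : π⁻¹ • K ⊆ p.2 := by
    have : π⁻¹ • K ⊆ π⁻¹ • π • p.2 := Set.smul_set_mono hK
    rwa [inv_smul_smul] at this
  have := h p hp (π⁻¹ • K) hsub (π⁻¹ * σ * π⁻¹⁻¹) (FinPerm.conj_fix hσ)
  rwa [inv_inv, mul_smul, mul_smul] at this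

theorem dropClosed_succConfigs (P : Set A.Config) (a : 𝔸) (N : Set 𝔸) :
    A.DropClosed (A.succConfigs P a N) := by
  rintro p' ⟨h1, p, hp, γ, q, π, hγ, hΔ, hf, hsub, hfix, e⟩ K hK σ hσ
  refine ⟨hK.trans h1, p, hp, γ, q, σ * π, hγ, hΔ, hf, hK.trans hsub, fun x hx => ?_, ?_⟩
  · rw [mul_smul, hfix x (hK hx), hσ x hx]
  · rw [mul_smul, ← e]

variable (A)

/-- The states of the deterministic automaton: at most `m` known names, and a drop-closed set of
configurations whose known names are among these. -/
@[ext]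
structure DetState (m : ℕ) where
  /-- The known names. -/
  names : Set 𝔸
  /-- The configurations that the automaton may be in. -/
  configs : Set A.Config
  finite_names : names.Finite
  ncard_names_le : names.ncard ≤ m
  snd_subset : ∀ p ∈ configs, p.2 ⊆ names
  dropClosed : A.DropClosed configs

variable {A} {m : ℕ}

namespace DetState

instance instMulAction : MulAction (FinPerm 𝔸) (A.DetState m) where
  smul π s :=
    { names := π • s.names
      configs := π • s.configs
      finite_names := s.finite_names.smul_set
      ncard_names_le := (Set.ncard_smul_set π s.names).trans_le s.ncard_names_le
      snd_subset := by
        rintro _ ⟨p, hp, rfl⟩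
        exact Set.smul_set_mono (s.snd_subset p hp)
      dropClosed := s.dropClosed.smul π }
  one_smul s := DetState.ext (one_smul _ _) (one_smul _ _)
  mul_smul π σ s := DetState.ext (mul_smul _ _ _) (mul_smul _ _ _)

theorem names_smul (π : FinPerm 𝔸) (s : A.DetState m) : (π • s).names = π • s.names := rfl

theorem configs_smul (π : FinPerm 𝔸) (s : A.DetState m) : (π • s).configs = π • s.configs := rfl

theorem supports_names (s : A.DetState m) :
    MulAction.Supports (FinPerm 𝔸) s.names s := by
  have key : ∀ π : FinPerm 𝔸, (∀ a ∈ s.names, π • a = a) → π • s.configs ⊆ s.configs := by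
    rintro π hπ _ ⟨p, hp, rfl⟩
    have hfix : ∀ a ∈ p.2, π • a = a := fun a ha => hπ a (s.snd_subset p hp ha)
    have := s.dropClosed p hp p.2 subset_rfl π hfix
    have e : (π • p.1, p.2) = π • p := Prod.ext rfl (FinPerm.smul_set_eq_of_fix hfix).symm
    rwa [e] at this
  intro π hπ
  have hπ' : ∀ a ∈ s.names, π⁻¹ • a = a := fun a ha => inv_smul_eq_iff.2 (hπ ha).symm
  refine DetState.ext (FinPerm.smul_set_eq_of_fix fun a ha => hπ ha)
    (Set.Subset.antisymm (key π fun a ha => hπ ha) ?_)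
  exact Set.subset_smul_set_iff.2 (key π⁻¹ hπ')

instance instNominal : Nominal 𝔸 (A.DetState m) where
  exists_finite_support s := ⟨s.names, s.finite_names, s.supports_names⟩

theorem supp_eq (s : A.DetState m) : supp 𝔸 s = s.names := by
  refine (Nominal.supp_subset s.finite_names s.supports_names).antisymm fun a ha => ?_
  rintro S ⟨hS, hSs⟩
  by_contra haS
  obtain ⟨d, hd⟩ := (hS.union s.finite_names).exists_notMem
  rw [Set.mem_union, not_or] at hd
  have h1 := congrArg names (Nominal.swap_smul_of_notMem hSs haS hd.1)
  have h2 : FinPerm.swap a d • a ∈ s.names := h1 ▸ Set.smul_mem_smul_set ha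
  rw [FinPerm.swap_smul_left] at h2
  exact hd.2 h2

/-- There are finitely many orbits: a finite permutation moves the known names into a fixed set `S`
of size `m`, and a drop-closed set of configurations is determined by the orbits of its elements
under the pointwise stabilizer of `S`. -/
instance instOrbitFinite :
    Finite (MulAction.orbitRel.Quotient (FinPerm 𝔸) (A.DetState m)) := by
  let S : ℕ → Set 𝔸 := fun k => Infinite.natEmbedding 𝔸 '' Set.Iio k
  have hS : ∀ k, (S k).Finite := fun k => (Set.finite_Iio k).image _
  have hcard : ∀ k, (S k).ncard = k := fun k => by
    rw [Set.ncard_image_of_injective _ (Infinite.natEmbedding 𝔸).injective]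
    simp
  have hρ : ∀ s : A.DetState m, ∃ ρ : FinPerm 𝔸, ρ • s.names = S s.names.ncard := fun s =>
    FinPerm.exists_smul_set_eq s.finite_names (hS _) (hcard _).symm
  choose ρ hρ using hρ
  have hρm : ∀ s : A.DetState m, (ρ s • s).names ⊆ S m := fun s => by
    rw [names_smul, hρ]
    exact Set.image_mono (Set.Iio_subset_Iio s.ncard_names_le)
  obtain ⟨ι, _, f, hf⟩ := Nominal.exists_classifier (X := A.State) (hS m)
  have := (hS m).to_subtype
  let g : A.DetState m → Fin (m + 1) × Set (ι × Set (S m)) := fun s =>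
    (⟨s.names.ncard, Nat.lt_succ_of_le s.ncard_names_le⟩,
      {z | ∃ p ∈ (ρ s • s).configs, f p.1 = z.1 ∧ p.2 = Subtype.val '' z.2})
  have hsub : ∀ s t, g s = g t → (ρ s • s).configs ⊆ (ρ t • t).configs := by
    intro s t h p hp
    have hpS : p.2 = Subtype.val '' (Subtype.val ⁻¹' p.2 : Set (S m)) := by
      rw [Subtype.image_preimage_coe, Set.inter_eq_right.2]
      exact ((ρ s • s).snd_subset p hp).trans (hρm s)
    have hz : (f p.1, (Subtype.val ⁻¹' p.2 : Set (S m))) ∈ (g t).2 := h ▸ ⟨p, hp, rfl, hpS⟩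
    obtain ⟨p', hp', h1, h2⟩ := hz
    rw [← hpS] at h2
    obtain ⟨π, hπ, e⟩ := hf _ _ h1
    have := (ρ t • t).dropClosed p' hp' p'.2 subset_rfl π fun x hx =>
      hπ x (hρm t ((ρ t • t).snd_subset p' hp' hx))
    rwa [e, h2] at this
  have key : ∀ s t, g s = g t → ρ s • s = ρ t • t := fun s t h =>
    DetState.ext (by
      have e : s.names.ncard = t.names.ncard := congrArg Fin.val (congrArg Prod.fst h)
      rw [names_smul, names_smul, hρ, hρ, e])
      ((hsub s t h).antisymm (hsub t s h.symm))
  refine Finite.of_injective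
    (fun o : MulAction.orbitRel.Quotient (FinPerm 𝔸) (A.DetState m) => g o.out) fun o o' h => ?_
  rw [← Quotient.out_eq o, ← Quotient.out_eq o']
  refine Quotient.sound (MulAction.orbitRel_apply.2 ⟨(ρ o.out)⁻¹ * ρ o'.out, ?_⟩)
  change ((ρ o.out)⁻¹ * ρ o'.out) • o'.out = o.out
  rw [mul_smul, ← key _ _ h, inv_smul_smul]

/-- The transitions of the deterministic automaton. The letter says which names are known afterwards,
and must be free or not according to whether its name is known; the configurations only depend on
its name and on the known names. -/
def Step (s : A.DetState m) (γ : Letter 𝔸) (t : A.DetState m) : Prop :=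
  (γ.IsFree ↔ γ.name ∈ s.names) ∧ t.names = γ.update s.names ∧
    t.configs = A.succConfigs s.configs γ.name t.names

theorem Step.smul {s t : A.DetState m} {γ : Letter 𝔸} (h : Step s γ t) (π : FinPerm 𝔸) :
    Step (π • s) (π • γ) (π • t) := by
  obtain ⟨h1, h2, h3⟩ := h
  refine ⟨?_, ?_, ?_⟩
  · rw [Letter.isFree_smul, h1, Letter.name_smul, names_smul, Set.smul_mem_smul_set_iff]
  · rw [names_smul, h2, names_smul, Letter.update_smul]
  · rw [configs_smul, h3, configs_smul, Letter.name_smul, names_smul, succConfigs_smul]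

theorem Step.unique {s t t' : A.DetState m} {γ : Letter 𝔸} (h : Step s γ t) (h' : Step s γ t') :
    t = t' := by
  have e := h.2.1.trans h'.2.1.symm
  exact DetState.ext e (by rw [h.2.2, h'.2.2, e])

/-- Invariance of a transition under renaming of its bound name: this name is not known before, so
that the renaming does not change the source. -/
theorem Step.rename {c : 𝔸 → Letter 𝔸} (hname : ∀ a, (c a).name = a) (hfree : ∀ a, ¬ (c a).IsFree)
    (hc : ∀ (π : FinPerm 𝔸) (a : 𝔸), π • c a = c (π • a))
    (hup : ∀ (a : 𝔸) (N : Set 𝔸), N ⊆ (c a).update N) {s t t' : A.DetState m} {a b : 𝔸}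
    (e : abstr a t = abstr b t') (h : Step s (c a) t) : Step s (c b) t' := by
  obtain ⟨d, hd⟩ := ((t.finite_names.union t'.finite_names).union
    (s.finite_names.union (Set.toFinite {a, b}))).exists_notMem
  simp only [Set.mem_union, Set.mem_insert_iff, Set.mem_singleton_iff, not_or] at hd
  obtain ⟨⟨hdt, hdt'⟩, hds, hda, hdb⟩ := hd
  have e := Nominal.absRel_any (Nominal.abstr_eq_iff.1 e) (d := d) hda hdb
    (by rwa [Fresh, supp_eq]) (by rwa [Fresh, supp_eq])
  simp only at e
  have ha : a ∉ s.names := fun ha => hfree a (h.1.2 (by rwa [hname]))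
  have hb : b ∉ s.names := by
    intro hb
    have hba : b ≠ a := by rintro rfl; exact ha hb
    have hbt : b ∈ t.names := h.2.1 ▸ hup a _ hb
    have : FinPerm.swap b d • FinPerm.swap a d • b ∈
        (FinPerm.swap b d • FinPerm.swap a d • t).names :=
      Set.smul_mem_smul_set (Set.smul_mem_smul_set hbt)
    rw [e, FinPerm.swap_smul_swap_smul, FinPerm.swap_smul_of_ne hba (Ne.symm hdb),
      FinPerm.swap_smul_left] at this
    exact hdt' this
  have h' := (h.smul (FinPerm.swap a d)).smul (FinPerm.swap b d)
  rw [e, FinPerm.swap_smul_swap_smul, hc, hc, FinPerm.swap_smul_left, FinPerm.swap_smul_right,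
    Nominal.swap_smul_of_notMem s.supports_names ha hds,
    Nominal.swap_smul_of_notMem s.supports_names hb hds] at h'
  exact h'

/-- A state has at most one successor, up to the choice of the bound name. -/
theorem Step.finite_abstr {c : 𝔸 → Letter 𝔸} (hname : ∀ a, (c a).name = a)
    (hfree : ∀ a, ¬ (c a).IsFree) (hc : ∀ (π : FinPerm 𝔸) (a : 𝔸), π • c a = c (π • a))
    (s : A.DetState m) :
    {x : Abstraction 𝔸 (A.DetState m) | ∃ a t, Step s (c a) t ∧ x = abstr a t}.Finite := by
  refine Set.Subsingleton.finite ?_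
  rintro _ ⟨a, t, h, rfl⟩ _ ⟨b, t', h', rfl⟩
  obtain ⟨d, hd⟩ := ((t.finite_names.union t'.finite_names).union
    (s.finite_names.union (Set.toFinite {a, b}))).exists_notMem
  simp only [Set.mem_union, Set.mem_insert_iff, Set.mem_singleton_iff, not_or] at hd
  obtain ⟨⟨hdt, hdt'⟩, hds, hda, hdb⟩ := hd
  have key : ∀ (a : 𝔸) (t : A.DetState m), Step s (c a) t →
      Step s (c d) (FinPerm.swap a d • t) := by
    intro a t h
    have ha : a ∉ s.names := fun ha => hfree a (h.1.2 (by rwa [hname]))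
    have h1 := h.smul (FinPerm.swap a d)
    rwa [hc, FinPerm.swap_smul_left, Nominal.swap_smul_of_notMem s.supports_names ha hds] at h1
  exact Nominal.abstr_eq_iff.2 ⟨d, hda, hdb, by rwa [Fresh, supp_eq], by rwa [Fresh, supp_eq],
    (key a t h).unique (key b t' h')⟩

theorem Step.finite_free {c : 𝔸 → Letter 𝔸} (hname : ∀ a, (c a).name = a)
    (hfree : ∀ a, (c a).IsFree) (s : A.DetState m) :
    {x : 𝔸 × A.DetState m | Step s (c x.1) x.2}.Finite := by
  refine Set.Finite.of_injOn (f := Prod.fst) (t := s.names) ?_ ?_ s.finite_names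
  · rintro ⟨a, t⟩ h
    have := h.1.1 (hfree a)
    rwa [hname] at this
  · rintro ⟨a, t⟩ h ⟨b, t'⟩ h' e
    cases e
    exact congrArg _ (h.unique h')

end DetState

/-- The names known initially are those of the initial state. -/
def initDetState (A : NDA 𝔸) {m : ℕ} (hm : (supp 𝔸 A.init).ncard ≤ m) : A.DetState m where
  names := supp 𝔸 A.init
  configs := {p | p.2 ⊆ supp 𝔸 A.init ∧
    ∃ π : FinPerm 𝔸, (∀ x ∈ p.2, π • x = x) ∧ p.1 = π • A.init}
  finite_names := Nominal.finite_supp A.init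
  ncard_names_le := hm
  snd_subset _ hp := hp.1
  dropClosed := by
    rintro p ⟨h1, π, hπ, e⟩ K hK σ hσ
    refine ⟨hK.trans h1, σ * π, fun x hx => ?_, ?_⟩
    · rw [mul_smul, hπ x (hK hx), hσ x hx]
    · rw [mul_smul, ← e]

/-- The deterministic automaton that simulates `A` with at most `m` known names. -/
def determinization (A : NDA 𝔸) {m : ℕ} (hm : (supp 𝔸 A.init).ncard ≤ m) : DDA 𝔸 where
  State := A.DetState m
  Δ := DetState.Step
  init := A.initDetState hm
  final := {s | ∃ p ∈ s.configs, p.1 ∈ A.final}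
  Δ_equivariant π _ _ _ h := h.smul π
  final_equivariant := by
    rintro π s ⟨p, hp, hF⟩
    exact ⟨π • p, Set.smul_mem_smul_set hp, A.final_equivariant π _ hF⟩
  left_alpha_alloc _ _ _ _ _ e h := DetState.Step.rename (c := .alloc) (fun _ => rfl)
    (fun _ => id) (fun _ _ => rfl) (fun _ _ => Set.subset_insert _ _) e h
  left_alpha_unknown _ _ _ _ _ e h := DetState.Step.rename (c := .unknown) (fun _ => rfl)
    (fun _ => id) (fun _ _ => rfl) (fun _ _ => subset_rfl) e h
  erasure_dealloc s t a h := by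
    rw [Fresh, DetState.supp_eq, h.2.1]
    exact fun ha => ha.2 rfl
  erasure_unknown s t a h := by
    rw [Fresh, DetState.supp_eq, h.2.1]
    exact fun ha => h.1.2 ha
  branching_use := DetState.Step.finite_free (c := .use) (fun _ => rfl) fun _ => trivial
  branching_alloc := DetState.Step.finite_abstr (c := .alloc) (fun _ => rfl) (fun _ => id)
    fun _ _ => rfl
  branching_dealloc := DetState.Step.finite_free (c := .dealloc) (fun _ => rfl) fun _ => trivial
  branching_unknown := DetState.Step.finite_abstr (c := .unknown) (fun _ => rfl) (fun _ => id)
    fun _ _ => rfl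
  deterministic _ _ _ _ h h' := h.unique h'

end NDA

/-! ### Correctness -/

namespace NDA

variable {𝔸 : Type u} [Infinite 𝔸] {A : NDA 𝔸}

/-- A configuration accepts `w` if, up to `α`-equivalence, its state does and only known names are
left-open in `w`. -/
def ConfigAccepts (A : NDA 𝔸) (p : A.Config) (w : Word 𝔸) : Prop :=
  Word.lo w ⊆ p.2 ∧ ∃ w', Word.AlphaEq w w' ∧ A.Accepts p.1 w'

theorem ConfigAccepts.of_smul {q : A.State} {K : Set 𝔸} {w : Word 𝔸} {π : FinPerm 𝔸}
    (hπ : ∀ x ∈ K, π • x = x) (h : A.ConfigAccepts (π • q, K) w) : A.ConfigAccepts (q, K) w := by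
  obtain ⟨h1, w', h2, h3⟩ := h
  refine ⟨h1, π⁻¹ • w', Word.AlphaEq.trans ?_ (h2.smul π⁻¹), ?_⟩
  · exact (Word.AlphaEq.smul_of_fix_lo h2.rns.1 fun x hx =>
      inv_smul_eq_iff.2 (hπ x (h1 hx)).symm).symm
  · simpa using h3.smul π⁻¹

theorem ConfigAccepts.mono {q : A.State} {K K' : Set 𝔸} {w : Word 𝔸} (hK : K ⊆ K')
    (h : A.ConfigAccepts (q, K) w) : A.ConfigAccepts (q, K') w :=
  ⟨h.1.trans hK, h.2⟩

theorem ConfigAccepts.cons {q q' : A.State} {K : Set 𝔸} {w : Word 𝔸} {γ : Letter 𝔸}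
    (hΔ : A.Δ q γ q') (hγ : γ.IsFree → γ.name ∈ K)
    (h : A.ConfigAccepts (q', insert γ.name K) w) : A.ConfigAccepts (q, K) (γ :: w) := by
  obtain ⟨h1, w', h2, h3⟩ := h
  cases γ with
  | use a =>
    refine ⟨Set.union_subset (h1.trans (Set.insert_subset (hγ trivial) subset_rfl))
      (Set.singleton_subset_iff.2 (hγ trivial)), _, h2.use a, q', hΔ, h3⟩
  | dealloc a =>
    refine ⟨Set.union_subset (h1.trans (Set.insert_subset (hγ trivial) subset_rfl))
      (Set.singleton_subset_iff.2 (hγ trivial)), _, h2.dealloc ?_, q', hΔ, h3⟩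
    rw [h2.lo_eq]
    exact fun ha => A.erasure_dealloc _ _ _ hΔ (h3.lo_subset_supp ha)
  | alloc a => exact ⟨fun x hx => (h1 hx.1).resolve_left hx.2, _, h2.alloc a, q', hΔ, h3⟩
  | unknown a =>
    refine ⟨fun x hx => (h1 hx.1).resolve_left hx.2, _, h2.unknown (a := a) (b := a) ?_, q', hΔ, h3⟩
    rw [h2.lo_eq, Set.pair_eq_singleton, Set.singleton_inter_eq_empty]
    exact fun ha => A.erasure_unknown _ _ _ hΔ (h3.lo_subset_supp ha)

/-- Soundness of the determinization, with the letters read by `A` recovered from the run. -/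
theorem exists_configAccepts {m : ℕ} {hm : (supp 𝔸 A.init).ncard ≤ m} {u : Word 𝔸}
    {s : A.DetState m} (h : (A.determinization hm).Accepts s u) :
    ∃ p ∈ s.configs, ∃ w, Word.db w = Word.db u ∧ A.ConfigAccepts p w := by
  induction u generalizing s with
  | nil =>
    obtain ⟨p, hp, hF⟩ := h
    exact ⟨p, hp, [], rfl, Set.empty_subset _, [], .nil, hF⟩
  | cons δ u ih =>
    obtain ⟨t, hst, ht⟩ := h
    obtain ⟨⟨q', K'⟩, hp', w, hw, hacc⟩ := ih ht
    have hst : DetState.Step s δ t := hst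
    rw [hst.2.2] at hp'
    obtain ⟨-, ⟨q, K⟩, hp, γ, q₁, π, hγ, hΔ, hf, hK, hπ, rfl⟩ := hp'
    refine ⟨(q, K), hp, γ :: w, ?_, ?_⟩
    · exact congrArg₂ List.cons hγ hw
    · refine ConfigAccepts.cons hΔ (by rwa [hγ]) ?_
      rw [hγ]
      exact (hacc.of_smul hπ).mono hK

/-- If `w` is accepted from `q` up to `α`-equivalence, then its first name can be read after
renaming the anonymous names of `q`, so that the rest of `w` is accepted from the new state. The
known names are exactly the left-open ones throughout. -/
theorem exists_configStep {q : A.State} {γ : Letter 𝔸} {v w' : Word 𝔸}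
    (h : Word.AlphaEq (γ :: v) w') (hacc : A.Accepts q w') :
    ∃ (π : FinPerm 𝔸) (q' : A.State) (v' : Word 𝔸), (∀ x ∈ Word.lo (γ :: v), π • x = x) ∧
      A.ConfigStep γ.name (π • q, Word.lo (γ :: v)) (q', Word.lo v) ∧
      Word.AlphaEq v v' ∧ A.Accepts q' v' := by
  -- It suffices to find a transition whose letter has the right name.
  suffices H : ∃ (π : FinPerm 𝔸) (δ : Letter 𝔸) (q' : A.State) (v' : Word 𝔸),
      (∀ x ∈ Word.lo (γ :: v), π • x = x) ∧ δ.name = γ.name ∧ A.Δ (π • q) δ q' ∧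
      (δ.IsFree → γ.name ∈ Word.lo (γ :: v)) ∧ Word.AlphaEq v v' ∧ A.Accepts q' v' by
    obtain ⟨π, δ, q', v', h1, h2, h3, h4, h5, h6⟩ := H
    refine ⟨π, q', v', h1, ⟨δ, q', 1, h2, h3, h4, fun x hx => ?_, fun x _ => one_smul _ x,
      (one_smul _ q').symm⟩, h5, h6⟩
    by_cases hxγ : x = γ.name
    · exact Or.inl hxγ
    · refine Or.inr ?_
      cases γ with
      | use a => exact Or.inl hx
      | dealloc a => exact Or.inl hx
      | alloc a => exact ⟨hx, hxγ⟩
      | unknown a => exact ⟨hx, hxγ⟩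
  have hrns := h.rns.1
  have hinv := h.inv
  cases γ with
  | use a =>
    obtain ⟨v', rfl, hv⟩ := hinv
    obtain ⟨q', hΔ, hq'⟩ := hacc
    exact ⟨1, .use a, q', v', fun x _ => one_smul _ x, rfl, by rwa [one_smul], fun _ => Or.inr rfl,
      hv, hq'⟩
  | dealloc a =>
    obtain ⟨v', rfl, hv⟩ := hinv
    obtain ⟨q', hΔ, hq'⟩ := hacc
    exact ⟨1, .dealloc a, q', v', fun x _ => one_smul _ x, rfl, by rwa [one_smul],
      fun _ => Or.inr rfl, hv, hq'⟩
  | unknown a =>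
    obtain ⟨b, v', rfl, hv⟩ := hinv
    obtain ⟨q', hΔ, hq'⟩ := hacc
    have ha := hrns.notMem_lo (Or.inr rfl)
    obtain ⟨d, hd⟩ := ((Word.lo_finite v).union (Nominal.finite_supp (𝔸 := 𝔸) q')).exists_notMem
    rw [Set.mem_union, not_or] at hd
    have hfix : ∀ x ∈ Word.lo v, FinPerm.swap a d • x = x := fun x hx =>
      FinPerm.swap_smul_of_ne (by rintro rfl; exact ha hx) (by rintro rfl; exact hd.1 hx)
    refine ⟨FinPerm.swap a d, .unknown a, FinPerm.swap a d • q', FinPerm.swap a d • v',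
      fun x hx => hfix x hx.1, rfl, ?_, False.elim, ?_, hq'.smul _⟩
    · -- Both bound names are fresh for the renamed target, so they may be exchanged.
      have hfa : Fresh a (FinPerm.swap a d • q') := by
        have := Nominal.fresh_smul (FinPerm.swap a d) (show Fresh d q' from hd.2)
        rwa [FinPerm.swap_smul_right] at this
      have hfb := Nominal.fresh_smul (FinPerm.swap a d) (A.erasure_unknown _ _ _ hΔ)
      exact A.left_alpha_unknown _ _ _ _ _ (Nominal.abstr_eq_of_fresh hfb hfa)
        (A.Δ_equivariant _ _ _ _ hΔ)
    · exact (Word.AlphaEq.smul_of_fix_lo hrns.tail hfix).symm.trans (hv.smul _)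
  | alloc a =>
    obtain ⟨b, v', rfl, S, hS, hv⟩ := hinv
    obtain ⟨q', hΔ, hq'⟩ := hacc
    obtain ⟨c, hc⟩ := ((hS.union (Word.lo_finite v)).union
      ((Nominal.finite_supp (𝔸 := 𝔸) q').union (Set.toFinite {b}))).exists_notMem
    simp only [Set.mem_union, Set.mem_singleton_iff, not_or] at hc
    obtain ⟨⟨hcS, hcv⟩, hcq, hcb⟩ := hc
    -- The name bound by `A` is first replaced by a fresh name `c`, then `c` is exchanged with `a`.
    refine ⟨FinPerm.swap a c, .alloc a, FinPerm.swap a c • FinPerm.swap b c • q',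
      FinPerm.swap a c • FinPerm.swap b c • v', fun x hx => ?_, rfl, ?_, False.elim, ?_,
      (hq'.smul _).smul _⟩
    · exact FinPerm.swap_smul_of_ne hx.2 (by rintro rfl; exact hcv hx.1)
    · have h1 : A.Δ q (.alloc c) (FinPerm.swap b c • q') :=
        A.left_alpha_alloc _ _ _ _ _ (Nominal.abstr_eq_swap hcb hcq) hΔ
      have h2 := A.Δ_equivariant (FinPerm.swap a c) _ _ _ h1
      have : FinPerm.swap a c • Letter.alloc c = .alloc a :=
        congrArg Letter.alloc (FinPerm.swap_smul_right a c)
      rwa [this] at h2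
    · have := (hv c hcS).smul (FinPerm.swap a c)
      rwa [FinPerm.swap_smul_swap_smul] at this

/-- Completeness of the determinization. The letters are chosen such that, apart from names of the
initial state, exactly the left-open names of the rest of the word are known. -/
theorem exists_accepts {n m : ℕ} (hn : ∀ q : A.State, (supp 𝔸 q).ncard ≤ n)
    (hm : n + (supp 𝔸 A.init).ncard ≤ m) (hm' : (supp 𝔸 A.init).ncard ≤ m) {w w' : Word 𝔸}
    {q : A.State} {s : A.DetState m} (hw : Word.AlphaEq w w') (hacc : A.Accepts q w')
    (hq : (q, Word.lo w) ∈ s.configs) (hs : s.names ⊆ Word.lo w ∪ supp 𝔸 A.init) :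
    ∃ u, Word.db u = Word.db w ∧ (A.determinization hm').Accepts s u := by
  induction w generalizing w' q s with
  | nil =>
    have : w' = [] := hw.inv
    subst this
    exact ⟨[], rfl, _, hq, hacc⟩
  | cons γ v ih =>
    obtain ⟨π, q', v', hπ, hstep, hv, hacc'⟩ := exists_configStep hw hacc
    -- The letter is determined by whether its name is known before and used later.
    obtain ⟨δ, hδ, hfree, hmem⟩ : ∃ δ : Letter 𝔸, δ.name = γ.name ∧
        (δ.IsFree ↔ γ.name ∈ s.names) ∧
        ∀ x, x ∈ δ.update s.names ↔ (x ∈ s.names ∧ x ≠ γ.name) ∨ (x = γ.name ∧ x ∈ Word.lo v) := by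
      by_cases h1 : γ.name ∈ s.names <;> by_cases h2 : γ.name ∈ Word.lo v
      · refine ⟨.use γ.name, rfl, by simp [h1, Letter.IsFree], fun x => ?_⟩
        by_cases hx : x = γ.name <;> simp [Letter.update, hx, h1, h2]
      · refine ⟨.dealloc γ.name, rfl, by simp [h1, Letter.IsFree], fun x => ?_⟩
        by_cases hx : x = γ.name <;> simp [Letter.update, hx, h2]
      · refine ⟨.alloc γ.name, rfl, by simp [h1, Letter.IsFree], fun x => ?_⟩
        by_cases hx : x = γ.name <;> simp [Letter.update, hx, h2]
      · refine ⟨.unknown γ.name, rfl, by simp [h1, Letter.IsFree], fun x => ?_⟩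
        by_cases hx : x = γ.name <;> simp [Letter.update, hx, h1, h2]
    have hlo : ∀ x, x ≠ γ.name → (x ∈ Word.lo (γ :: v) ↔ x ∈ Word.lo v) := by
      intro x hx
      cases γ <;> simp only [Letter.name] at hx <;> simp [Word.lo, hx]
    have hsub : Word.lo v ⊆ δ.update s.names := by
      intro x hx
      rw [hmem]
      by_cases hxγ : x = γ.name
      · exact Or.inr ⟨hxγ, hx⟩
      · exact Or.inl ⟨s.snd_subset _ hq ((hlo x hxγ).2 hx), hxγ⟩
    have hsup : δ.update s.names ⊆ Word.lo v ∪ supp 𝔸 A.init := by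
      intro x hx
      rcases (hmem x).1 hx with ⟨hx, hxγ⟩ | ⟨-, hx⟩
      · exact (hs hx).imp_left (hlo x hxγ).1
      · exact Or.inl hx
    have hfin : (Word.lo v ∪ supp 𝔸 A.init).Finite :=
      (Word.lo_finite v).union (Nominal.finite_supp A.init)
    have hcard : (δ.update s.names).ncard ≤ m := by
      have h1 : (Word.lo v).ncard ≤ n := by
        rw [hv.lo_eq]
        exact (Set.ncard_le_ncard hacc'.lo_subset_supp (Nominal.finite_supp q')).trans (hn q')
      exact (Set.ncard_le_ncard hsup hfin).trans ((Set.ncard_union_le _ _).trans (by omega))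
    let t : A.DetState m :=
      { names := δ.update s.names
        configs := A.succConfigs s.configs γ.name (δ.update s.names)
        finite_names := hfin.subset hsup
        ncard_names_le := hcard
        snd_subset := fun p hp => hp.1
        dropClosed := dropClosed_succConfigs _ _ _ }
    obtain ⟨u, hu, ht⟩ := ih (s := t) hv hacc'
      ⟨hsub, _, s.dropClosed _ hq _ subset_rfl π hπ, hstep⟩ hsup
    refine ⟨δ :: u, congrArg₂ List.cons hδ hu, t, ⟨by rwa [hδ], rfl, ?_⟩, ht⟩
    rw [hδ]

theorem dataLanguage_determinization {n m : ℕ} (hn : ∀ q : A.State, (supp 𝔸 q).ncard ≤ n)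
    (hm : n + (supp 𝔸 A.init).ncard ≤ m) (hm' : (supp 𝔸 A.init).ncard ≤ m) :
    (A.determinization hm').dataLanguage = localFreshness A.alphaticLanguage := by
  ext x
  constructor
  · rintro ⟨u, hu, rfl⟩
    obtain ⟨⟨q, K⟩, ⟨-, π, hπ, rfl⟩, w, hdb, hacc⟩ := exists_configAccepts hu
    obtain ⟨-, w', hw, hacc'⟩ := hacc.of_smul hπ
    exact ⟨⟨w, hw.rns.1⟩, ⟨⟨w', hw.rns.2⟩, hacc', Quotient.sound hw.symm⟩, hdb⟩
  · rintro ⟨⟨w, hw⟩, ⟨⟨w', hw'⟩, hacc, e⟩, rfl⟩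
    have h : Word.AlphaEq w w' := (Quotient.exact e).symm
    have hlo : Word.lo w ⊆ supp 𝔸 A.init := by
      rw [h.lo_eq]
      exact hacc.lo_subset_supp
    obtain ⟨u, hu, hu'⟩ := exists_accepts hn hm hm' (s := A.initDetState hm') h hacc
      ⟨hlo, 1, fun x _ => one_smul _ x, (one_smul _ _).symm⟩ Set.subset_union_right
    exact ⟨u, hu', hu⟩

end NDA

theorem mainTheorem1 {𝔸 : Type u} [Countable 𝔸] [Infinite 𝔸] (A : NDA 𝔸) :
    ∃ B : DDA 𝔸, B.toNDA.dataLanguage = localFreshness A.alphaticLanguage := by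
  obtain ⟨n, hn⟩ := Nominal.exists_ncard_supp_le (𝔸 := 𝔸) (X := A.State)
  exact ⟨A.determinization (Nat.le_add_left _ _), NDA.dataLanguage_determinization hn le_rfl _⟩
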